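/- Notation. Let $M$ be a smooth manifold and $\mathbb{T}M=TM\oplus T^*M$, with $\langle X+\alpha,Y+\beta\rangle=\tfrac12(\alpha(Y)+\beta(X))$, the Dorfman bracket $[X+\alpha,Y+\beta]=[X,Y]+\mathcal L_X\beta-i_Yd\alpha$ and the projection $a:\mathbb{T}M\to TM$. Let $\mathcal E'(M)=\mathbb{T}M\oplus\mathrm{span}(\partial_t,dt)$ be the restriction to $M$ of the generalized tangent bundle of the cone $M\times(0,\infty)$. Here $\partial_t$ is the Euler vector field and $dt$ the dual invariant $1$-form, and the sections of $\mathcal E'(M)$ are identified with the $\mathbb{R}^+$-invariant sections over the cone. The inherited inner product of $\mathbf x_1+p_1\partial_t+q_1dt$ and $\mathbf x_2+p_2\partial_t+q_2dt$ is $\langle\mathbf x_1,\mathbf x_2\rangle+\tfrac12(p_1q_2+p_2q_1)$, and the inherited bracket is $$[\mathbf x_1,\mathbf x_2]+q_2\,dp_1+p_2\,dq_1+\big(a(\mathbf x_1)p_2-a(\mathbf x_2)p_1\big)\partial_t+\big(a(\mathbf x_1)q_2-a(\mathbf x_2)q_1\big)dt .$$ Let $\mathrm{Sek}_0(M)$ be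 the set of bundle endomorphisms $J$ of $\mathcal E'(M)$ with $J^2=-1$, $J^*=-J$ and $J(\mathrm{span}(\partial_t,dt))\subseteq\mathbb{T}M$. Such a $J$ is integrable if $[J\mathbf X,J\mathbf Y]-[\mathbf X,\mathbf Y]-J([J\mathbf X,\mathbf Y]+[\mathbf X,J\mathbf Y])=0$ for all sections $\mathbf X,\mathbf Y$. Its associated triple is $(\Phi,\mathbf e_1,\mathbf e_2)$ with $\mathbf e_1=J(\partial_t)$, $\mathbf e_2=J(dt)$ and $\Phi$ the restriction of $J$ to $\mathbb{T}M$ followed by the orthogonal projection onto $\mathbb{T}M$. It represents the generalized almost contact structure $(E,L)$, where $E=\mathrm{span}(\mathbf e_1,\mathbf e_2)$ and $L\subseteq\mathbb{T}M\otimes\mathbb{C}$ is the $\sqrt{-1}$-eigenbundle of $\Phi$. A complex subbundle $P$ of $\mathbb{T}M\otimes\mathbb{C}$ is involutive if $[\Gamma(P),\Gamma(P)]\subseteq\Gamma(P)$. The pair $(E,L)$ is integrable (respectively strongly integrable) if $L\oplus(\ell\otimes\mathbb{C})$ is involutive for some (respectively for every) maximal isotropic subbundle $\ell$ of $E$. The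 pair $(E,L)$ is normal if it is represented by some integrable element of $\mathrm{Sek}_0(M)$. A triple is normal if the element of $\mathrm{Sek}_0(M)$ to which it is associated is integrable. On $S^3\subset\mathbb{R}^4$ consider the vector fields $$V_1=x_2\partial_1-x_1\partial_2+x_4\partial_3-x_3\partial_4,\quad V_2=x_3\partial_1-x_4\partial_2-x_1\partial_3+x_2\partial_4,\quad V_3=x_4\partial_1+x_3\partial_2-x_2\partial_3-x_1\partial_4,$$ with dual coframe $\nu_1,\nu_2,\nu_3$. Let $j$ be the endomorphism of $TS^3\oplus\mathrm{span}(\partial_t)$ with $j(V_1)=\partial_t$, $j(\partial_t)=-V_1$, $j(V_2)=V_3$, $j(V_3)=-V_2$. For $f,g\in C^\infty(S^3)$ let $$\Lambda=f\,(-V_1\wedge V_3+V_2\wedge\partial_t)+g\,(V_1\wedge V_2+V_3\wedge\partial_t),$$ acting on $1$-forms by $(U\wedge W)(\xi)=\xi(U)W-\xi(W)U$, and let $J=\begin{bmatrix} j&\Lambda\\0&-j^*\end{bmatrix}$ on $\mathcal E'(S^3)$. **Proposition.** For all $f,g\in C^\infty(S^3)$ one has $J\in\mathrm{Sek}_0(S^3)$.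 Let $(\Phi,\mathbf e_1,\mathbf e_2)$ be the triple associated to $J$ and $(E,L)$ the generalized almost contact structure that it represents. Then: (i) $(E,L)$ is integrable; (ii) $(E,L)$ is strongly integrable if and only if $L$ is involutive, if and only if $$V_2(g)+V_3(f)=0,\qquad V_2(f)-V_3(g)=0;$$ (iii) $(E,L)$ is normal if and only if the equations in (ii) hold and in addition $$V_1(g)+2f=0,\qquad V_1(f)-2g=0;$$ the triple $(\Phi,\mathbf e_1,\mathbf e_2)$ is normal under exactly the same conditions. -/

import Mathlib

open scoped Manifold ContDiff

noncomputable section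

namespace GenContact

/-! ## The generalized tangent bundle through its smooth sections

Throughout, `A` stands for the algebra `C^∞(M)` of a smooth manifold `M`.  Vector fields are the
derivations of `A`, 1-forms are the `A`-linear functionals on vector fields, base-fixing bundle
morphisms are the `A`-linear maps between modules of sections, and vector subbundles are the
`A`-submodules of sections that are direct summands.  Below this is applied to `M = S³`. -/

section General

variable (A : Type*) [CommRing A] [Algebra ℝ A]

/-- Vector fields, `Γ(TM)`. -/
abbrev VF := Derivation ℝ A A

/-- 1-forms, `Γ(T*M)`. -/
abbrev Form1 := Module.Dual A (VF A)

/-- Sections `X + α = (X, α)` of the generalized tangent bundle `𝕋M = TM ⊕ T*M`. -/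
abbrev GT := VF A × Form1 A

/-- Sections `x + √-1 y = (x, y)` of the complexification `𝕋M ⊗ ℂ`. -/
abbrev GTC := GT A × GT A

/-- Sections `x + p ∂ₜ + q dt = (x, (p, q))` (with `p q : A`) of the restriction `𝓔'(M)` to `M` of
the generalized tangent bundle of the cone `C(M) = M × (0, ∞)`.  Here `∂ₜ` is the Euler vector
field, which generates the multiplicative action of `ℝ⁺` on the cone, and `dt` is the invariant
1-form dual to it.  These are the same as the `ℝ⁺`-invariant sections over `C(M)`. -/
abbrev ConeGT := GT A × (A × A)

variable {A}

/-- The differential of a function, `(dh)(Z) = Z(h)`. -/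
def diff (h : A) : Form1 A where
  toFun Z := Z h
  map_add' Z W := by simp
  map_smul' a Z := by simp

/-- The Lie derivative of a 1-form, `(𝓛_X β)(Z) = X(β(Z)) - β([X, Z])`. -/
def lieForm (X : VF A) (β : Form1 A) : Form1 A where
  toFun Z := X (β Z) - β ⁅X, Z⁆
  map_add' Z W := by simp only [map_add, lie_add]; ring
  map_smul' a Z := by
    have h : ⁅X, a • Z⁆ = a • ⁅X, Z⁆ + (X a) • Z := by
      ext b
      simp [Derivation.commutator_apply]
    rw [h]
    simp only [map_smul, map_add, smul_eq_mul, Derivation.leibniz, RingHom.id_apply]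
    ring

/-- The contraction `i_Y dα`, where `dα(Y, Z) = Y(α(Z)) - Z(α(Y)) - α([Y, Z])`. -/
def contrD (Y : VF A) (α : Form1 A) : Form1 A :=
  lieForm Y α - diff (α Y)

/-- The inner product `⟨X + α, Y + β⟩ = (α(Y) + β(X)) / 2`. -/
def pair (x y : GT A) : A := (1 / 2 : ℝ) • (x.2 y.1 + y.2 x.1)

/-- The Dorfman bracket `[X + α, Y + β] = [X, Y] + 𝓛_X β - i_Y dα`. -/
def dorfman (x y : GT A) : GT A :=
  (⁅x.1, y.1⁆, lieForm x.1 y.2 - contrD y.1 x.2)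

/-- The `ℂ`-bilinear extension of the Dorfman bracket. -/
def dorfmanC (z w : GTC A) : GTC A :=
  (dorfman z.1 w.1 - dorfman z.2 w.2, dorfman z.1 w.2 + dorfman z.2 w.1)

/-- `[Γ(P), Γ(P)] ⊆ Γ(P)`. -/
def IsInvolutive (P : Submodule A (GTC A)) : Prop :=
  ∀ z ∈ P, ∀ w ∈ P, dorfmanC z w ∈ P

/-- Subbundles of `𝕋M`, as modules of sections: the direct summands. -/
def IsSubbundle (P : Submodule A (GT A)) : Prop := ∃ Q, IsCompl P Q

/-- The isotropic subbundles of the subbundle `E`. -/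
def IsIsotropicIn (E l : Submodule A (GT A)) : Prop :=
  IsSubbundle l ∧ l ≤ E ∧ ∀ x ∈ l, ∀ y ∈ l, pair x y = 0

/-- The maximal isotropic subbundles of `E`. -/
def IsMaxIsotropicIn (E l : Submodule A (GT A)) : Prop := Maximal (IsIsotropicIn E) l

/-- The complexification `l ⊗ ℂ`. -/
def complexify (l : Submodule A (GT A)) : Submodule A (GTC A) := l.prod l

/-- Integrability of a generalized almost contact structure `(E, L)`. -/
def IsIntegrable (E : Submodule A (GT A)) (L : Submodule A (GTC A)) : Prop :=
  ∃ l, IsMaxIsotropicIn E l ∧ IsInvolutive (L ⊔ complexify l)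

/-- Strong integrability of a generalized almost contact structure `(E, L)`. -/
def IsStronglyIntegrable (E : Submodule A (GT A)) (L : Submodule A (GTC A)) : Prop :=
  ∀ l, IsMaxIsotropicIn E l → IsInvolutive (L ⊔ complexify l)

/-- The `√-1`-eigenbundle of `Φ`: `Φ(x + √-1 y) = √-1 (x + √-1 y)` says `Φ x = -y`, `Φ y = x`. -/
def eigenbundle (Φ : GT A →ₗ[A] GT A) : Submodule A (GTC A) where
  carrier := {z | Φ z.1 = -z.2 ∧ Φ z.2 = z.1}
  add_mem' := by
    rintro z w ⟨h1, h2⟩ ⟨h3, h4⟩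
    refine ⟨?_, ?_⟩
    · simp only [Prod.fst_add, Prod.snd_add, map_add, h1, h3]; abel
    · simp only [Prod.fst_add, Prod.snd_add, map_add, h2, h4]
  zero_mem' := by simp
  smul_mem' := by
    rintro a z ⟨h1, h2⟩
    refine ⟨?_, ?_⟩
    · simp only [Prod.smul_fst, Prod.smul_snd, map_smul, h1, smul_neg]
    · simp only [Prod.smul_fst, Prod.smul_snd, map_smul, h2]

/-! ### The cone -/

/-- The inner product on `𝓔'(M)`. -/
def conePair (X Y : ConeGT A) : A :=
  pair X.1 Y.1 + (1 / 2 : ℝ) • (X.2.1 * Y.2.2 + Y.2.1 * X.2.2)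

/-- The Dorfman bracket of the cone, on `ℝ⁺`-invariant sections: for `X₁ = x₁ + p₁ ∂ₜ + q₁ dt` and
`X₂ = x₂ + p₂ ∂ₜ + q₂ dt` it is `[x₁, x₂] + q₂ dp₁ + p₂ dq₁` plus
`(a(x₁)(p₂) - a(x₂)(p₁)) ∂ₜ + (a(x₁)(q₂) - a(x₂)(q₁)) dt`. -/
def coneBracket (X Y : ConeGT A) : ConeGT A :=
  (dorfman X.1 Y.1 + (0, Y.2.2 • diff X.2.1 + Y.2.1 • diff X.2.2),
    (X.1.1 Y.2.1 - Y.1.1 X.2.1, X.1.1 Y.2.2 - Y.1.1 X.2.2))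

/-- The Euler vector field `∂ₜ` as a section of `𝓔'(M)`. -/
def eulerT : ConeGT A := (0, (1, 0))

/-- The 1-form `dt` as a section of `𝓔'(M)`. -/
def dT : ConeGT A := (0, (0, 1))

/-- The set `Sek₀(M)` of `ℝ⁺`-invariant generalized almost complex structures on the cone
(`J² = -1`, `J* = -J`) with `J(span(∂ₜ, dt)) ⊆ 𝕋M`. -/
structure IsSek0 (J : ConeGT A →ₗ[A] ConeGT A) : Prop where
  sq : ∀ X, J (J X) = -X
  skew : ∀ X Y, conePair (J X) Y = -conePair X (J Y)
  euler_mem : (J eulerT).2 = 0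
  dT_mem : (J dT).2 = 0

/-- Integrability of the generalized almost complex structure `J`. -/
def IsIntegrableJ (J : ConeGT A →ₗ[A] ConeGT A) : Prop :=
  ∀ X Y, coneBracket (J X) (J Y) - coneBracket X Y
    - J (coneBracket (J X) Y + coneBracket X (J Y)) = 0

/-- The endomorphism `Φ` of the triple `(Φ, e₁, e₂)` associated to `J`: the restriction of `J` to
`𝕋M` followed by the orthogonal projection `𝓔'(M) → 𝕋M`. -/
def tripleΦ (J : ConeGT A →ₗ[A] ConeGT A) : GT A →ₗ[A] GT A :=
  LinearMap.fst A (GT A) (A × A) ∘ₗ J ∘ₗ LinearMap.inl A (GT A) (A × A)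

/-- The section `e₁ = J(∂ₜ)` of the triple associated to `J`. -/
def tripleE1 (J : ConeGT A →ₗ[A] ConeGT A) : GT A := (J eulerT).1

/-- The section `e₂ = J(dt)` of the triple associated to `J`. -/
def tripleE2 (J : ConeGT A →ₗ[A] ConeGT A) : GT A := (J dT).1

/-- The bundle `E = span(e₁, e₂)` of the generalized almost contact structure represented by
`J`. -/
def bundleE (J : ConeGT A →ₗ[A] ConeGT A) : Submodule A (GT A) :=
  Submodule.span A {tripleE1 J, tripleE2 J}

/-- The bundle `L`, the `√-1`-eigenbundle of `Φ`, of the generalized almost contact structure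
represented by `J`. -/
def bundleL (J : ConeGT A →ₗ[A] ConeGT A) : Submodule A (GTC A) :=
  eigenbundle (tripleΦ J)

/-- Normality of a triple: the element of `Sek₀(M)` associated to it is integrable. -/
def IsNormalTriple (Φ : GT A →ₗ[A] GT A) (e₁ e₂ : GT A) : Prop :=
  ∃ J : ConeGT A →ₗ[A] ConeGT A, IsSek0 J ∧ tripleΦ J = Φ ∧ tripleE1 J = e₁ ∧ tripleE2 J = e₂ ∧
    IsIntegrableJ J

/-- Normality of a generalized almost contact structure: it is represented by an integrable
element of `Sek₀(M)`. -/
def IsNormal (E : Submodule A (GT A)) (L : Submodule A (GTC A)) : Prop :=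
  ∃ J : ConeGT A →ₗ[A] ConeGT A, IsSek0 J ∧ bundleE J = E ∧ bundleL J = L ∧ IsIntegrableJ J

/-! ### Block matrices on the cone -/

variable (A) in
/-- Sections `X + p ∂ₜ = (X, p)` of the tangent part of `𝓔'(M)`. -/
abbrev ConeVF := VF A × A

variable (A) in
/-- Sections `α + q dt = (α, q)` of the cotangent part of `𝓔'(M)`. -/
abbrev ConeForm := Form1 A × A

/-- The evaluation `(α + q dt)(X + p ∂ₜ) = α(X) + q p`. -/
def coneEval (ξ : ConeForm A) (U : ConeVF A) : A := ξ.1 U.1 + ξ.2 * U.2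

/-- The dual map `j*`, `(j* ξ)(U) = ξ(j U)`. -/
def coneDual (j : ConeVF A →ₗ[A] ConeVF A) : ConeForm A →ₗ[A] ConeForm A where
  toFun ξ :=
    ({ toFun := fun Z => coneEval ξ (j (Z, 0))
       map_add' := by
        intro Z W
        have h : ((Z + W, 0) : ConeVF A) = (Z, 0) + (W, 0) := by simp
        rw [h, map_add]
        simp only [coneEval, Prod.fst_add, Prod.snd_add, map_add]
        ring
       map_smul' := by
        intro a Z
        have h : ((a • Z, 0) : ConeVF A) = a • (Z, 0) := by simp
        rw [h, map_smul]
        simp only [coneEval, Prod.smul_fst, Prod.smul_snd, map_smul, smul_eq_mul,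
          RingHom.id_apply]
        ring },
      coneEval ξ (j (0, 1)))
  map_add' ξ η := by
    refine Prod.ext (LinearMap.ext fun Z => ?_) ?_ <;>
      simp [coneEval] <;> ring
  map_smul' a ξ := by
    refine Prod.ext (LinearMap.ext fun Z => ?_) ?_ <;>
      simp [coneEval] <;> ring

/-- The bivector `U ∧ W` as the map `ξ ↦ i_ξ (U ∧ W) = ξ(U) W - ξ(W) U`. -/
def wedge (U W : ConeVF A) : ConeForm A →ₗ[A] ConeVF A where
  toFun ξ := coneEval ξ U • W - coneEval ξ W • U
  map_add' ξ η := by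
    simp only [coneEval, Prod.fst_add, Prod.snd_add, LinearMap.add_apply, add_mul, add_smul]
    abel
  map_smul' a ξ := by
    simp only [coneEval, Prod.smul_fst, Prod.smul_snd, LinearMap.smul_apply, smul_eq_mul,
      RingHom.id_apply, mul_assoc, ← mul_add, mul_smul, smul_sub]

/-- The tangent part of a section of `𝓔'(M)`. -/
def vecPart : ConeGT A →ₗ[A] ConeVF A where
  toFun X := (X.1.1, X.2.1)
  map_add' _ _ := rfl
  map_smul' _ _ := rfl

/-- The cotangent part of a section of `𝓔'(M)`. -/
def formPart : ConeGT A →ₗ[A] ConeForm A where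
  toFun X := (X.1.2, X.2.2)
  map_add' _ _ := rfl
  map_smul' _ _ := rfl

/-- The section of `𝓔'(M)` with given tangent and cotangent parts. -/
def assemble : ConeVF A × ConeForm A →ₗ[A] ConeGT A where
  toFun P := ((P.1.1, P.2.1), (P.1.2, P.2.2))
  map_add' _ _ := rfl
  map_smul' _ _ := rfl

/-- The endomorphism of `𝓔'(M)` with block matrix `[[j, Λ], [0, -j*]]`. -/
def blockJ (j : ConeVF A →ₗ[A] ConeVF A) (Λ : ConeForm A →ₗ[A] ConeVF A) :
    ConeGT A →ₗ[A] ConeGT A :=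
  assemble ∘ₗ LinearMap.prod (j ∘ₗ vecPart + Λ ∘ₗ formPart) (-(coneDual j ∘ₗ formPart))

end General

/-! ## The sphere -/

/-- `ℝ⁴` with its Euclidean norm; the coordinates `x₁, x₂, x₃, x₄` are `x 0, x 1, x 2, x 3`. -/
abbrev R4 := EuclideanSpace ℝ (Fin 4)

/-- The unit sphere `S³` in `ℝ⁴`. -/
abbrev S3 := Metric.sphere (0 : R4) 1

instance finrankR4 : Fact (Module.finrank ℝ R4 = 3 + 1) := ⟨by simp⟩

/-- The algebra `C^∞(S³)`. -/
abbrev CS3 := C^∞⟮𝓡 3, S3; ℝ⟯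

/-- A linear vector field on `ℝ⁴` that is orthogonal to the position vector and has its length. -/
structure UnitField where
  toLin : R4 →ₗ[ℝ] R4
  norm_eq : ∀ x, ‖toLin x‖ = ‖x‖
  orth : ∀ x, inner ℝ x (toLin x) = 0

/-- The linear vector field `x₂ ∂₁ - x₁ ∂₂ + x₄ ∂₃ - x₃ ∂₄`. -/
def field1 : UnitField where
  toLin :=
    { toFun := fun x => !₂[x 1, -x 0, x 3, -x 2]
      map_add' := by intro x y; ext i; fin_cases i <;> simp <;> ring
      map_smul' := by intro c x; ext i; fin_cases i <;> simp }
  norm_eq x := by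
    simp only [LinearMap.coe_mk, AddHom.coe_mk, EuclideanSpace.norm_eq, Fin.sum_univ_four]
    congr 1; simp; ring
  orth x := by simp [PiLp.inner_apply, Fin.sum_univ_four]; ring

/-- The linear vector field `x₃ ∂₁ - x₄ ∂₂ - x₁ ∂₃ + x₂ ∂₄`. -/
def field2 : UnitField where
  toLin :=
    { toFun := fun x => !₂[x 2, -x 3, -x 0, x 1]
      map_add' := by intro x y; ext i; fin_cases i <;> simp <;> ring
      map_smul' := by intro c x; ext i; fin_cases i <;> simp }
  norm_eq x := by
    simp only [LinearMap.coe_mk, AddHom.coe_mk, EuclideanSpace.norm_eq, Fin.sum_univ_four]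
    congr 1; simp; ring
  orth x := by simp [PiLp.inner_apply, Fin.sum_univ_four]; ring

/-- The linear vector field `x₄ ∂₁ + x₃ ∂₂ - x₂ ∂₃ - x₁ ∂₄`. -/
def field3 : UnitField where
  toLin :=
    { toFun := fun x => !₂[x 3, x 2, -x 1, -x 0]
      map_add' := by intro x y; ext i; fin_cases i <;> simp <;> ring
      map_smul' := by intro c x; ext i; fin_cases i <;> simp }
  norm_eq x := by
    simp only [LinearMap.coe_mk, AddHom.coe_mk, EuclideanSpace.norm_eq, Fin.sum_univ_four]
    congr 1; simp; ring
  orth x := by simp [PiLp.inner_apply, Fin.sum_univ_four]; ring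

lemma circle_mem (a : UnitField) (p : ℝ × S3) :
    Real.cos p.1 • (p.2 : R4) + Real.sin p.1 • a.toLin p.2 ∈ Metric.sphere (0 : R4) 1 := by
  have hx : ‖(p.2 : R4)‖ = 1 := by simp
  have h : ‖Real.cos p.1 • (p.2 : R4) + Real.sin p.1 • a.toLin p.2‖ ^ 2 = 1 := by
    rw [norm_add_sq_real, norm_smul, norm_smul, a.norm_eq, hx, inner_smul_left, inner_smul_right,
      a.orth]
    simp
  rw [mem_sphere_zero_iff_norm]
  nlinarith [norm_nonneg (Real.cos p.1 • (p.2 : R4) + Real.sin p.1 • a.toLin p.2)]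

/-- The great circle `t ↦ cos t x + sin t a(x)` in `S³`, which passes through `x` at `t = 0` with
velocity `a(x)`. -/
def circle (a : UnitField) : ℝ × S3 → S3 :=
  Set.codRestrict _ _ (circle_mem a)

lemma circle_contMDiff (a : UnitField) :
    ContMDiff (𝓘(ℝ, ℝ).prod (𝓡 3)) (𝓡 3) ∞ (circle a) := by
  refine ContMDiff.codRestrict_sphere ?_ (circle_mem a)
  have hx : ContMDiff (𝓘(ℝ, ℝ).prod (𝓡 3)) 𝓘(ℝ, R4) ∞ (fun p : ℝ × S3 => (p.2 : R4)) :=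
    contMDiff_coe_sphere.comp contMDiff_snd
  have hc : ContMDiff (𝓘(ℝ, ℝ).prod (𝓡 3)) 𝓘(ℝ, ℝ) ∞ (fun p : ℝ × S3 => Real.cos p.1) :=
    Real.contDiff_cos.contMDiff.comp contMDiff_fst
  have hs : ContMDiff (𝓘(ℝ, ℝ).prod (𝓡 3)) 𝓘(ℝ, ℝ) ∞ (fun p : ℝ × S3 => Real.sin p.1) :=
    Real.contDiff_sin.contMDiff.comp contMDiff_fst
  have ha : ContMDiff (𝓘(ℝ, ℝ).prod (𝓡 3)) 𝓘(ℝ, R4) ∞ (fun p : ℝ × S3 => a.toLin p.2) :=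
    (LinearMap.toContinuousLinearMap a.toLin).contMDiff.comp hx
  exact (hc.smul hx).add (hs.smul ha)

lemma circle_zero (a : UnitField) (x : S3) : circle a (0, x) = x := by
  apply Subtype.ext
  simp [circle]

lemma comp_circle_contMDiff (a : UnitField) (h : CS3) :
    ContMDiff (𝓘(ℝ, ℝ).prod (𝓡 3)) 𝓘(ℝ, ℝ) ∞ (fun p : ℝ × S3 => h (circle a p)) :=
  h.contMDiff.comp (circle_contMDiff a)

lemma comp_circle_differentiable (a : UnitField) (h : CS3) (x : S3) :
    DifferentiableAt ℝ (fun t : ℝ => h (circle a (t, x))) 0 := by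
  have h1 : ContMDiff 𝓘(ℝ, ℝ) 𝓘(ℝ, ℝ) ∞ (fun t : ℝ => h (circle a (t, x))) :=
    (comp_circle_contMDiff a h).comp (contMDiff_id.prodMk contMDiff_const)
  exact (h1.contDiff.differentiable (by simp)).differentiableAt

lemma deriv_circle_contMDiff (a : UnitField) (h : CS3) :
    ContMDiff (𝓡 3) 𝓘(ℝ, ℝ) ∞ (fun x : S3 => deriv (fun t : ℝ => h (circle a (t, x))) 0) := by
  intro x₀
  have hf : ContMDiffAt ((𝓡 3).prod 𝓘(ℝ, ℝ)) 𝓘(ℝ, ℝ) ∞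
      (Function.uncurry fun (x : S3) (t : ℝ) => h (circle a (t, x))) (x₀, (0 : ℝ)) :=
    ((comp_circle_contMDiff a h).comp (contMDiff_snd.prodMk contMDiff_fst)).contMDiffAt
  have h2 := ContMDiffAt.mfderiv_apply (m := ∞) (n := ∞) (I := 𝓘(ℝ, ℝ)) (I' := 𝓘(ℝ, ℝ))
    (x₀ := x₀) (fun (x : S3) (t : ℝ) => h (circle a (t, x))) (fun _ => (0 : ℝ))
    (fun x => x) (fun _ => (1 : ℝ)) hf contMDiffAt_const contMDiffAt_id contMDiffAt_const (by simp)
  simpa [inTangentCoordinates_model_space, mfderiv_eq_fderiv] using h2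

/-- The vector field on `S³` obtained by restricting a linear vector field `a`: its value on a
function `h` at `x` is the derivative of `h` at `x` in the direction `a(x)`. -/
def sphereVF (a : UnitField) : VF CS3 :=
  Derivation.mk'
    { toFun := fun h => ⟨fun x => deriv (fun t : ℝ => h (circle a (t, x))) 0,
        deriv_circle_contMDiff a h⟩
      map_add' := by
        intro h k
        ext x
        exact deriv_fun_add (comp_circle_differentiable a h x) (comp_circle_differentiable a k x)
      map_smul' := by
        intro c h
        ext x
        exact deriv_fun_const_smul c (comp_circle_differentiable a h x) }
    (by
      intro h k
      ext x
      have := deriv_fun_mul (comp_circle_differentiable a h x) (comp_circle_differentiable a k x)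
      simp only [circle_zero] at this
      refine this.trans ?_
      change _ = h x * deriv (fun t : ℝ => k (circle a (t, x))) 0 +
        k x * deriv (fun t : ℝ => h (circle a (t, x))) 0
      ring)

/-- The vector field `V₁` on `S³`. -/
def V1 : VF CS3 := sphereVF field1

/-- The vector field `V₂` on `S³`. -/
def V2 : VF CS3 := sphereVF field2

/-- The vector field `V₃` on `S³`. -/
def V3 : VF CS3 := sphereVF field3

/-- The `k`-th coordinate of a linear map `ℝ⁴ → ℝ⁴`, as a smooth function on `S³`. -/
def coordFun (u : R4 →ₗ[ℝ] R4) (k : Fin 4) : CS3 :=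
  ⟨fun x => u x k, by
    have h1 : ContMDiff (𝓡 3) 𝓘(ℝ, R4) ∞ (fun x : S3 => u x) :=
      (LinearMap.toContinuousLinearMap u).contMDiff.comp contMDiff_coe_sphere
    exact (EuclideanSpace.proj k : R4 →L[ℝ] ℝ).contMDiff.comp h1⟩

/-- The 1-form `X ↦ ∑ₖ aₖ X(xₖ)`, the Euclidean inner product with the linear vector field `a`.
The three fields below are orthonormal at each point of `S³`, so their 1-forms are the coframe
dual to the vector fields that they induce. -/
def sphereForm (a : UnitField) : Form1 CS3 where
  toFun X := ∑ k, coordFun a.toLin k * X (coordFun LinearMap.id k)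
  map_add' X Y := by simp [mul_add, Finset.sum_add_distrib]
  map_smul' c X := by
    simp only [Derivation.smul_apply, smul_eq_mul, RingHom.id_apply, Finset.mul_sum]
    exact Finset.sum_congr rfl fun k _ => by ring

/-- The 1-form `ν₁` of the coframe dual to `V₁, V₂, V₃`. -/
def ν1 : Form1 CS3 := sphereForm field1

/-- The 1-form `ν₂` of the coframe dual to `V₁, V₂, V₃`. -/
def ν2 : Form1 CS3 := sphereForm field2

/-- The 1-form `ν₃` of the coframe dual to `V₁, V₂, V₃`. -/
def ν3 : Form1 CS3 := sphereForm field3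

/-- The almost complex structure on the cone with `j(V₁) = ∂ₜ`, `j(∂ₜ) = -V₁`, `j(V₂) = V₃`,
`j(V₃) = -V₂`. -/
def sphereSmallJ : ConeVF CS3 →ₗ[CS3] ConeVF CS3 where
  toFun U := (-(U.2 • V1) + ν2 U.1 • V3 - ν3 U.1 • V2, ν1 U.1)
  map_add' U W := by
    refine Prod.ext ?_ ?_
    · simp only [Prod.fst_add, Prod.snd_add, map_add, add_smul]; abel
    · simp
  map_smul' c U := by
    refine Prod.ext ?_ ?_
    · simp only [Prod.smul_fst, Prod.smul_snd, map_smul, smul_eq_mul, mul_smul, smul_sub,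
        smul_add, smul_neg, RingHom.id_apply]
    · simp

/-- The bivector `f (-V₁ ∧ V₃ + V₂ ∧ ∂ₜ) + g (V₁ ∧ V₂ + V₃ ∧ ∂ₜ)`. -/
def sphereΛ (f g : CS3) : ConeForm CS3 →ₗ[CS3] ConeVF CS3 :=
  f • (-wedge (V1, 0) (V3, 0) + wedge (V2, 0) (0, 1)) +
    g • (wedge (V1, 0) (V2, 0) + wedge (V3, 0) (0, 1))

/-- The generalized almost complex structure `J = [[j, Λ], [0, -j*]]` attached to `f, g`. -/
def sphereJ (f g : CS3) : ConeGT CS3 →ₗ[CS3] ConeGT CS3 :=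
  blockJ sphereSmallJ (sphereΛ f g)

/-- The bundle `E` of the generalized almost contact structure on `S³` attached to `f, g`. -/
def sphereE (f g : CS3) : Submodule CS3 (GT CS3) := bundleE (sphereJ f g)

/-- The bundle `L` of the generalized almost contact structure on `S³` attached to `f, g`. -/
def sphereL (f g : CS3) : Submodule CS3 (GTC CS3) := bundleL (sphereJ f g)

end GenContact

end

/-! The theorem is first reduced to algebra over `C^∞(S³)`. A derivation that kills the four
coordinate functions is zero (`derivation_eq_zero_of_coord`, by Hadamard's lemma and local
retractions onto the sphere). Hence identities between vector fields can be tested on coordinates,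
and `V₁, V₂, V₃` is a global frame with `[V₁, V₂] = 2V₃` and its cyclic permutations
(`sphereFrame`). All brackets then have explicit components (`dorfman_sec`, `coneBracket_csec`).

Write `i` for `√-1` and `h = f - i g`. Here `e₁ = -V₁`, `e₂ = -(f V₂ + g V₃ + ν₁)`, and `L` is
spanned by `V₂ - i V₃` and `ν₂ - i ν₃ - h V₁`. The sum `L ⊕ e₁` is spanned by `V₁`, `V₂ - i V₃`, `ν₂
- i ν₃`; it does not depend on `f, g` and is always involutive, which gives (i). Bracketing the
generators of `L` leaves the obstruction `(V₂ - i V₃) h = 0`, whose real and imaginary parts are the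
equations in (ii); they also make `L ⊕ e₂` involutive. Since `S³` is connected, `e₁` and `e₂` span
the only maximal isotropic subbundles of `E` (`eq_span_of_isMaxIsotropicIn`), and `L` is the
intersection of the two sums, so (ii) follows.

The extra equations in (iii) say `V₁ h = 2 i h`. Sufficiency is a direct computation with `J`. For
necessity an arbitrary representative `K` has to be treated (`equations_of_isIntegrableJ`): it
agrees with `J` on `E^⊥` and exchanges `E` with `span(∂ₜ, dt)`, and three values of its Nijenhuis
tensor already force all the equations. -/

noncomputable section

namespace GenContact

/-! ### Smooth parameter integrals and Hadamard's lemma -/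

section Hadamard

variable {E F : Type} [NormedAddCommGroup E] [NormedSpace ℝ E] [ProperSpace E]
  [NormedAddCommGroup F] [NormedSpace ℝ F]

/-- Differentiation under the integral sign for a smooth integrand on a compact interval. -/
lemma hasFDerivAt_intervalIntegral_of_contDiff {G : E × ℝ → F} (hG : ContDiff ℝ ∞ G) (x₀ : E) :
    HasFDerivAt (fun x => ∫ t in (0 : ℝ)..1, G (x, t))
      (∫ t in (0 : ℝ)..1, (fderiv ℝ G (x₀, t)).comp (ContinuousLinearMap.inl ℝ E ℝ)) x₀ := by
  have hD : Continuous fun p : E × ℝ =>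
      (fderiv ℝ G p).comp (ContinuousLinearMap.inl ℝ E ℝ) :=
    (hG.continuous_fderiv (by simp)).clm_comp continuous_const
  obtain ⟨C, hC⟩ := ((isCompact_closedBall x₀ 1).prod
    (isCompact_Icc (a := (0 : ℝ)) (b := 1))).exists_bound_of_continuousOn hD.continuousOn
  refine intervalIntegral.hasFDerivAt_integral_of_dominated_of_fderiv_le (s := Metric.ball x₀ 1)
    (bound := fun _ => C)
    (F' := fun x t => (fderiv ℝ G (x, t)).comp (ContinuousLinearMap.inl ℝ E ℝ))
    (Metric.ball_mem_nhds x₀ one_pos) ?_ ?_ ?_ ?_ ?_ ?_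
  · exact Filter.Eventually.of_forall fun x =>
      (hG.continuous.comp (Continuous.prodMk_right x)).aestronglyMeasurable
  · exact (hG.continuous.comp (Continuous.prodMk_right x₀)).intervalIntegrable _ _
  · exact (hD.comp (Continuous.prodMk_right x₀)).aestronglyMeasurable
  · refine Filter.Eventually.of_forall fun t ht x hx =>
      hC (x, t) ⟨Metric.ball_subset_closedBall hx, ?_⟩
    rw [Set.uIoc_of_le zero_le_one] at ht
    exact Set.Ioc_subset_Icc_self ht
  · exact intervalIntegrable_const
  · refine Filter.Eventually.of_forall fun t _ x _ => ?_
    have h1 : HasFDerivAt G (fderiv ℝ G (x, t)) (x, t) :=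
      (hG.differentiable (by simp)).differentiableAt.hasFDerivAt
    exact h1.comp x (hasFDerivAt_prodMk_left x t)

/-- Integrals of smooth functions over a compact interval depend smoothly on parameters. -/
lemma contDiff_intervalIntegral {G : E × ℝ → F} (hG : ContDiff ℝ ∞ G) :
    ContDiff ℝ ∞ (fun x => ∫ t in (0 : ℝ)..1, G (x, t)) := by
  rw [contDiff_infty]
  intro n
  -- The derivative is an integral of the same kind with values in `E →L[ℝ] F`, so the target space
  -- must vary in the induction.
  induction n generalizing F with
  | zero =>
    exact contDiff_zero.2 (continuous_iff_continuousAt.2 fun x =>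
      (hasFDerivAt_intervalIntegral_of_contDiff hG x).continuousAt)
  | succ n ih =>
    have h := hasFDerivAt_intervalIntegral_of_contDiff hG
    rw [Nat.cast_succ, contDiff_succ_iff_hasFDerivAt]
    refine ⟨_, ?_, h⟩
    refine ih (G := fun p => (fderiv ℝ G p).comp (ContinuousLinearMap.inl ℝ E ℝ)) ?_
    exact (hG.fderiv_right (by simp)).clm_comp contDiff_const

/-- Hadamard's lemma. -/
lemma exists_contDiff_sub_eq {H : E → ℝ} (hH : ContDiff ℝ ∞ H) (p : E) :
    ∃ K : E → E →L[ℝ] ℝ, (∀ e, ContDiff ℝ ∞ fun y => K y e) ∧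
      ∀ y, H y - H p = K y (y - p) := by
  have hline : ContDiff ℝ ∞ fun q : E × ℝ => p + q.2 • (q.1 - p) := by fun_prop
  have hI : ∀ y : E, Continuous fun t : ℝ => fderiv ℝ H (p + t • (y - p)) := fun y =>
    (hH.continuous_fderiv (by simp)).comp (by fun_prop)
  have hK : ∀ y e, (∫ t in (0 : ℝ)..1, fderiv ℝ H (p + t • (y - p))) e =
      ∫ t in (0 : ℝ)..1, fderiv ℝ H (p + t • (y - p)) e := fun y e =>
    ContinuousLinearMap.intervalIntegral_apply ((hI y).intervalIntegrable _ _) e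
  refine ⟨fun y => ∫ t in (0 : ℝ)..1, fderiv ℝ H (p + t • (y - p)), fun e => ?_, fun y => ?_⟩
  · simp only [hK]
    exact contDiff_intervalIntegral (G := fun q : E × ℝ => fderiv ℝ H (p + q.2 • (q.1 - p)) e)
      (((hH.fderiv_right (by simp)).comp hline).clm_apply contDiff_const)
  · rw [hK]
    have h2 : ∀ t ∈ Set.uIcc (0 : ℝ) 1,
        HasDerivAt (fun t : ℝ => H (p + t • (y - p))) (fderiv ℝ H (p + t • (y - p)) (y - p)) t := by
      intro t _
      have h3 : HasDerivAt (fun t : ℝ => p + t • (y - p)) (y - p) t := by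
        simpa using ((hasDerivAt_id t).smul_const (y - p)).const_add p
      exact ((hH.differentiable (by simp)).differentiableAt.hasFDerivAt).comp_hasDerivAt t h3
    rw [intervalIntegral.integral_eq_sub_of_hasDerivAt h2
      (((hI y).clm_apply continuous_const).intervalIntegrable _ _)]
    simp

end Hadamard

/-! ### Derivations of `C^∞(S³)` are determined by the coordinates -/

section Sphere

/-- The `k`-th coordinate function on `S³`. -/
abbrev coord (k : Fin 4) : CS3 := coordFun LinearMap.id k

/-- Restriction to `S³` of a smooth function on `ℝ⁴`. -/
def restrictS3 (H : R4 → ℝ) (hH : ContDiff ℝ ∞ H) : CS3 :=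
  ⟨fun x => H x, hH.contMDiff.comp contMDiff_coe_sphere⟩

@[simp]
lemma restrictS3_apply (H : R4 → ℝ) (hH : ContDiff ℝ ∞ H) (x : S3) :
    restrictS3 H hH x = H x := rfl

/-- Near each point of `S³` there is a smooth retraction of `ℝ⁴`, up to a cutoff `χ`. -/
lemma exists_local_retraction (p : S3) :
    ∃ (r : R4 → S3) (χ : CS3), ContMDiff 𝓘(ℝ, R4) (𝓡 3) ∞ r ∧ χ p = 1 ∧ r p = p ∧
      ∀ x : S3, χ x = 0 ∨ r x = x := by
  let s : R4 → ℝ := fun y => inner ℝ (p : R4) y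
  have hs : ContDiff ℝ ∞ s := contDiff_const.inner ℝ contDiff_id
  have hT : ContDiff ℝ ∞ Real.smoothTransition := Real.smoothTransition.contDiff
  -- Adding a multiple of `p` keeps `ψ` in the open half-space `⟨p, ·⟩ > 0`, so that it can be
  -- normalized everywhere; nothing is added where `⟨p, y⟩ ≥ 1/2`, and `χ` vanishes wherever `⟨p, y⟩
  -- ≤ 1/2`.
  let ψ : R4 → R4 := fun y => y + ((1 - Real.smoothTransition (2 * s y)) * (1 - s y)) • (p : R4)
  have hψ : ContDiff ℝ ∞ ψ := by
    have h1 : ContDiff ℝ ∞ fun y => 1 - Real.smoothTransition (2 * s y) :=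
      contDiff_const.sub (hT.comp (contDiff_const.mul hs))
    exact contDiff_id.add ((h1.mul (contDiff_const.sub hs)).smul contDiff_const)
  have hp : ‖(p : R4)‖ = 1 := by simp
  have hpp : inner ℝ (p : R4) (p : R4) = 1 := by rw [real_inner_self_eq_norm_sq, hp]; norm_num
  have hpos : ∀ y, 0 < inner ℝ (p : R4) (ψ y) := by
    intro y
    have h1 : inner ℝ (p : R4) (ψ y) =
        s y + (1 - Real.smoothTransition (2 * s y)) * (1 - s y) := by
      simp only [ψ, inner_add_right, inner_smul_right, hpp, mul_one, s]
    rw [h1]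
    rcases le_or_gt (s y) 0 with h | h
    · rw [Real.smoothTransition.zero_of_nonpos (by linarith)]; linarith
    · have h2 := Real.smoothTransition.pos_of_pos (x := 2 * s y) (by linarith)
      have h3 := Real.smoothTransition.le_one (2 * s y)
      nlinarith [mul_pos h2 h]
  have hne : ∀ y, ψ y ≠ 0 := fun y h => by simpa [h] using hpos y
  have hmem : ∀ y, ‖ψ y‖⁻¹ • ψ y ∈ Metric.sphere (0 : R4) 1 := fun y => by
    rw [mem_sphere_zero_iff_norm, norm_smul, norm_inv, norm_norm,
      inv_mul_cancel₀ (norm_ne_zero_iff.2 (hne y))]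
  have hr : ContDiff ℝ ∞ fun y => ‖ψ y‖⁻¹ • ψ y :=
    ((hψ.norm ℝ hne).inv fun y => norm_ne_zero_iff.2 (hne y)).smul hψ
  have hfix : ∀ x : S3, 1 / 2 ≤ s x → Set.codRestrict _ _ hmem (x : R4) = x := by
    intro x hx
    have h1 : ψ x = x := by
      simp only [ψ]
      rw [Real.smoothTransition.one_of_one_le (by linarith)]
      simp
    apply Subtype.ext
    simp [Set.codRestrict, h1]
  refine ⟨Set.codRestrict _ _ hmem,
    restrictS3 (fun y => Real.smoothTransition (2 * s y - 1))
      (hT.comp ((contDiff_const.mul hs).sub contDiff_const)),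
    ContMDiff.codRestrict_sphere hr.contMDiff hmem, ?_, hfix p (by simp only [s, hpp]; norm_num),
    fun x => ?_⟩
  · simp only [restrictS3_apply, s, hpp]
    exact Real.smoothTransition.one_of_one_le (by norm_num)
  · rcases le_or_gt (1 / 2) (s x) with h | h
    · exact Or.inr (hfix x h)
    · exact Or.inl (Real.smoothTransition.zero_of_nonpos (by linarith))

/-- A derivation of `C^∞(S³)` that kills the coordinate functions is zero. -/
lemma derivation_eq_zero_of_coord (D : VF CS3) (hD : ∀ k, D (coord k) = 0) : D = 0 := by
  ext h p
  obtain ⟨r, χ, hr, hχ, hrp, hχr⟩ := exists_local_retraction p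
  have hH : ContDiff ℝ ∞ fun y => h (r y) := contMDiff_iff_contDiff.1 (h.contMDiff.comp hr)
  obtain ⟨K, hK, hKeq⟩ := exists_contDiff_sub_eq hH (p : R4)
  -- Locality of `D`: applying `D` to this product and evaluating at `p`, where `χ = 1` and the
  -- difference vanishes, shows that `h` may be replaced by the restriction of `h ∘ r`.
  have h1 : χ * (h - restrictS3 _ hH) = 0 := by
    ext x
    rcases hχr x with hx | hx
    · change χ x * _ = 0
      rw [hx, zero_mul]
    · change χ x * (h x - h (r x)) = 0
      rw [hx, sub_self, mul_zero]
  have h2 : D h p = D (restrictS3 _ hH) p := by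
    have h3 := congrArg (fun k : CS3 => k p) (congrArg D h1)
    simp only [Derivation.leibniz, map_zero, smul_eq_mul, map_sub] at h3
    have h4 : χ p * (D h p - D (restrictS3 _ hH) p) + (h p - h (r p)) * D χ p = 0 := h3
    rw [hχ, hrp] at h4
    linarith
  let b := EuclideanSpace.basisFun (Fin 4) ℝ
  -- The Hadamard expansion at `p`. As `D` kills constants and coordinates, every surviving term of
  -- its image keeps a factor `xₖ - pₖ`.
  have h5 : restrictS3 _ hH = algebraMap ℝ CS3 (h p) +
      ∑ k, (coord k - algebraMap ℝ CS3 ((p : R4) k)) * restrictS3 (fun y => K y (b k)) (hK _) := by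
    ext x
    have h6 : h (r x) - h (r p) = K x (x - p) := hKeq x
    have h7 : (x : R4) - p = ∑ k, ((x : R4) k - (p : R4) k) • b k := by
      simpa [b] using (b.sum_repr ((x : R4) - p)).symm
    rw [h7, map_sum, hrp] at h6
    simp only [map_smul, smul_eq_mul] at h6
    have h8 : (∑ k, (coord k - algebraMap ℝ CS3 ((p : R4) k)) *
        restrictS3 (fun y => K y (b k)) (hK _) : CS3) x =
        ∑ k, ((x : R4) k - (p : R4) k) * K x (b k) := by
      simp only [Fin.sum_univ_four]; rfl
    change h (r x) = h p + _
    rw [h8, ← h6]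
    ring
  rw [h2, h5]
  simp only [map_add, map_sum, Derivation.map_algebraMap, Derivation.leibniz, map_sub, hD,
    smul_eq_mul, sub_zero, mul_zero, add_zero, zero_add]
  have h9 : ∀ (k : Fin 4) (F : CS3), ((coord k - algebraMap ℝ CS3 ((p : R4) k)) * F) p = 0 := by
    intro k F
    change ((p : R4) k - (p : R4) k) * F p = 0
    rw [sub_self, zero_mul]
  rw [Fin.sum_univ_four]
  simp only [ContMDiffMap.coe_add, Pi.add_apply, h9, add_zero]
  rfl

end Sphere

/-! ### Brackets and inner products in components -/

section Frames

variable (A : Type*) [CommRing A] [Algebra ℝ A]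

/-- A global frame of vector fields with the structure constants of `𝔰𝔲(2)`, and its dual
coframe. -/
structure SU2Frame where
  v1 : VF A
  v2 : VF A
  v3 : VF A
  n1 : Form1 A
  n2 : Form1 A
  n3 : Form1 A
  n1_v1 : n1 v1 = 1
  n1_v2 : n1 v2 = 0
  n1_v3 : n1 v3 = 0
  n2_v1 : n2 v1 = 0
  n2_v2 : n2 v2 = 1
  n2_v3 : n2 v3 = 0
  n3_v1 : n3 v1 = 0
  n3_v2 : n3 v2 = 0
  n3_v3 : n3 v3 = 1
  expand : ∀ X : VF A, X = n1 X • v1 + n2 X • v2 + n3 X • v3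
  lie12 : ⁅v1, v2⁆ = (2 : A) • v3
  lie23 : ⁅v2, v3⁆ = (2 : A) • v1
  lie31 : ⁅v3, v1⁆ = (2 : A) • v2

variable {A}

namespace SU2Frame

variable (F : SU2Frame A)

attribute [simp] n1_v1 n1_v2 n1_v3 n2_v1 n2_v2 n2_v3 n3_v1 n3_v2 n3_v3

/-- The section of `𝕋M` with given components. -/
def sec (a1 a2 a3 b1 b2 b3 : A) : GT A :=
  (a1 • F.v1 + a2 • F.v2 + a3 • F.v3, b1 • F.n1 + b2 • F.n2 + b3 • F.n3)

lemma vf_apply (a1 a2 a3 b1 b2 b3 h : A) : (F.sec a1 a2 a3 b1 b2 b3).1 h =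
    a1 * F.v1 h + a2 * F.v2 h + a3 * F.v3 h := rfl

lemma form_ext {α β : Form1 A} (h1 : α F.v1 = β F.v1) (h2 : α F.v2 = β F.v2)
    (h3 : α F.v3 = β F.v3) : α = β := by
  ext X
  rw [F.expand X]
  simp only [map_add, map_smul, h1, h2, h3]

lemma form_expand (α : Form1 A) :
    α = α F.v1 • F.n1 + α F.v2 • F.n2 + α F.v3 • F.n3 := by
  apply F.form_ext <;> simp

lemma exists_sec (x : GT A) : ∃ a1 a2 a3 b1 b2 b3, x = F.sec a1 a2 a3 b1 b2 b3 :=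
  ⟨_, _, _, _, _, _, Prod.ext (F.expand x.1) (F.form_expand x.2)⟩

lemma sec_inj {a1 a2 a3 b1 b2 b3 c1 c2 c3 d1 d2 d3 : A} :
    F.sec a1 a2 a3 b1 b2 b3 = F.sec c1 c2 c3 d1 d2 d3 ↔
      a1 = c1 ∧ a2 = c2 ∧ a3 = c3 ∧ b1 = d1 ∧ b2 = d2 ∧ b3 = d3 := by
  constructor
  · intro h
    have h1 := congrArg Prod.fst h
    have h2 := congrArg Prod.snd h
    simp only [sec] at h1 h2
    have k1 := congrArg F.n1 h1
    have k2 := congrArg F.n2 h1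
    have k3 := congrArg F.n3 h1
    have l1 := congrArg (fun α : Form1 A => α F.v1) h2
    have l2 := congrArg (fun α : Form1 A => α F.v2) h2
    have l3 := congrArg (fun α : Form1 A => α F.v3) h2
    simp at k1 k2 k3 l1 l2 l3
    exact ⟨k1, k2, k3, l1, l2, l3⟩
  · rintro ⟨rfl, rfl, rfl, rfl, rfl, rfl⟩
    rfl

lemma sec_add (a1 a2 a3 b1 b2 b3 c1 c2 c3 d1 d2 d3 : A) :
    F.sec a1 a2 a3 b1 b2 b3 + F.sec c1 c2 c3 d1 d2 d3 =
      F.sec (a1 + c1) (a2 + c2) (a3 + c3) (b1 + d1) (b2 + d2) (b3 + d3) := by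
  refine Prod.ext ?_ ?_ <;> simp only [sec, Prod.mk_add_mk] <;> module

lemma sec_sub (a1 a2 a3 b1 b2 b3 c1 c2 c3 d1 d2 d3 : A) :
    F.sec a1 a2 a3 b1 b2 b3 - F.sec c1 c2 c3 d1 d2 d3 =
      F.sec (a1 - c1) (a2 - c2) (a3 - c3) (b1 - d1) (b2 - d2) (b3 - d3) := by
  refine Prod.ext ?_ ?_ <;> simp only [sec, Prod.mk_sub_mk] <;> module

lemma sec_neg (a1 a2 a3 b1 b2 b3 : A) :
    -F.sec a1 a2 a3 b1 b2 b3 = F.sec (-a1) (-a2) (-a3) (-b1) (-b2) (-b3) := by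
  refine Prod.ext ?_ ?_ <;> simp only [sec, Prod.neg_mk] <;> module

lemma sec_smul (h a1 a2 a3 b1 b2 b3 : A) :
    h • F.sec a1 a2 a3 b1 b2 b3 =
      F.sec (h * a1) (h * a2) (h * a3) (h * b1) (h * b2) (h * b3) := by
  refine Prod.ext ?_ ?_ <;> simp only [sec, Prod.smul_mk] <;> module

lemma sec_zero : F.sec 0 0 0 0 0 0 = 0 := by
  refine Prod.ext ?_ ?_ <;> simp [sec]

lemma _root_.GenContact.two_mul_half_smul (a : A) : 2 * ((1 / 2 : ℝ) • a) = a := by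
  rw [← smul_eq_mul, ← map_ofNat (algebraMap ℝ A) 2, algebraMap_smul, smul_smul]
  norm_num

lemma _root_.GenContact.two_mul_pair (x y : GT A) : 2 * pair x y = x.2 y.1 + y.2 x.1 :=
  two_mul_half_smul _

lemma two_mul_pair_sec (a1 a2 a3 b1 b2 b3 c1 c2 c3 d1 d2 d3 : A) :
    2 * pair (F.sec a1 a2 a3 b1 b2 b3) (F.sec c1 c2 c3 d1 d2 d3) =
      b1 * c1 + b2 * c2 + b3 * c3 + (d1 * a1 + d2 * a2 + d3 * a3) := by
  rw [two_mul_pair]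
  simp [sec]

lemma smul_diff_add_smul_diff (h k p q : A) : ((0, h • diff p + k • diff q) : GT A) =
    F.sec 0 0 0 (h * F.v1 p + k * F.v1 q) (h * F.v2 p + k * F.v2 q)
      (h * F.v3 p + k * F.v3 q) := by
  refine Prod.ext (by simp [sec]) ?_
  apply F.form_ext <;> simp [sec, diff]

lemma lie_smul_smul (X Y : VF A) (a b : A) :
    ⁅a • X, b • Y⁆ = (a * b) • ⁅X, Y⁆ + (a * X b) • Y - (b * Y a) • X := by
  ext h
  simp [Derivation.commutator_apply]
  ring

lemma lie21 : ⁅F.v2, F.v1⁆ = -((2 : A) • F.v3) := by rw [← lie_skew, F.lie12]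
lemma lie32 : ⁅F.v3, F.v2⁆ = -((2 : A) • F.v1) := by rw [← lie_skew, F.lie23]
lemma lie13 : ⁅F.v1, F.v3⁆ = -((2 : A) • F.v2) := by rw [← lie_skew, F.lie31]

lemma lie_smul_left (X Y : VF A) (a : A) : ⁅a • X, Y⁆ = a • ⁅X, Y⁆ - (Y a) • X := by
  ext h
  simp [Derivation.commutator_apply]
  ring

lemma lie_comb (a1 a2 a3 c1 c2 c3 : A) :
    ⁅a1 • F.v1 + a2 • F.v2 + a3 • F.v3, c1 • F.v1 + c2 • F.v2 + c3 • F.v3⁆ =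
      (a1 * F.v1 c1 + a2 * F.v2 c1 + a3 * F.v3 c1 - (c1 * F.v1 a1 + c2 * F.v2 a1 + c3 * F.v3 a1)
        + 2 * (a2 * c3 - a3 * c2)) • F.v1 +
      (a1 * F.v1 c2 + a2 * F.v2 c2 + a3 * F.v3 c2 - (c1 * F.v1 a2 + c2 * F.v2 a2 + c3 * F.v3 a2)
        + 2 * (a3 * c1 - a1 * c3)) • F.v2 +
      (a1 * F.v1 c3 + a2 * F.v2 c3 + a3 * F.v3 c3 - (c1 * F.v1 a3 + c2 * F.v2 a3 + c3 * F.v3 a3)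
        + 2 * (a1 * c2 - a2 * c1)) • F.v3 := by
  simp only [lie_add, add_lie, lie_smul_smul, lie_self, F.lie12, F.lie23, F.lie31, F.lie21,
    F.lie32, F.lie13]
  module

/-- The terms with a factor 2 are cross products coming from the structure constants of `𝔰𝔲(2)`; the
others differentiate the coefficients. Once this is available, involutivity questions become
polynomial identities in coefficients and their derivatives. -/
lemma dorfman_sec (a1 a2 a3 b1 b2 b3 c1 c2 c3 d1 d2 d3 : A) :
    dorfman (F.sec a1 a2 a3 b1 b2 b3) (F.sec c1 c2 c3 d1 d2 d3) =
    F.sec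
      (a1 * F.v1 c1 + a2 * F.v2 c1 + a3 * F.v3 c1 - (c1 * F.v1 a1 + c2 * F.v2 a1 + c3 * F.v3 a1)
        + 2 * (a2 * c3 - a3 * c2))
      (a1 * F.v1 c2 + a2 * F.v2 c2 + a3 * F.v3 c2 - (c1 * F.v1 a2 + c2 * F.v2 a2 + c3 * F.v3 a2)
        + 2 * (a3 * c1 - a1 * c3))
      (a1 * F.v1 c3 + a2 * F.v2 c3 + a3 * F.v3 c3 - (c1 * F.v1 a3 + c2 * F.v2 a3 + c3 * F.v3 a3)
        + 2 * (a1 * c2 - a2 * c1))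
      (a1 * F.v1 d1 + a2 * F.v2 d1 + a3 * F.v3 d1 - (c1 * F.v1 b1 + c2 * F.v2 b1 + c3 * F.v3 b1)
        + 2 * (a2 * d3 - a3 * d2) - 2 * (c2 * b3 - c3 * b2)
        + (d1 * F.v1 a1 + d2 * F.v1 a2 + d3 * F.v1 a3)
        + (c1 * F.v1 b1 + c2 * F.v1 b2 + c3 * F.v1 b3))
      (a1 * F.v1 d2 + a2 * F.v2 d2 + a3 * F.v3 d2 - (c1 * F.v1 b2 + c2 * F.v2 b2 + c3 * F.v3 b2)
        + 2 * (a3 * d1 - a1 * d3) - 2 * (c3 * b1 - c1 * b3)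
        + (d1 * F.v2 a1 + d2 * F.v2 a2 + d3 * F.v2 a3)
        + (c1 * F.v2 b1 + c2 * F.v2 b2 + c3 * F.v2 b3))
      (a1 * F.v1 d3 + a2 * F.v2 d3 + a3 * F.v3 d3 - (c1 * F.v1 b3 + c2 * F.v2 b3 + c3 * F.v3 b3)
        + 2 * (a1 * d2 - a2 * d1) - 2 * (c1 * b2 - c2 * b1)
        + (d1 * F.v3 a1 + d2 * F.v3 a2 + d3 * F.v3 a3)
        + (c1 * F.v3 b1 + c2 * F.v3 b2 + c3 * F.v3 b3)) := by
  refine Prod.ext (F.lie_comb _ _ _ _ _ _) ?_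
  apply F.form_ext <;>
  · simp only [dorfman, sec, contrD, lieForm, diff, LinearMap.coe_mk, AddHom.coe_mk,
      LinearMap.sub_apply, LinearMap.add_apply, LinearMap.smul_apply, add_lie, lie_smul_left,
      lie_self, F.lie12, F.lie23, F.lie31, F.lie21, F.lie32, F.lie13, map_add, map_sub, map_neg,
      map_smul, smul_eq_mul, n1_v1, n1_v2, n1_v3, n2_v1, n2_v2, n2_v3, n3_v1, n3_v2, n3_v3,
      Derivation.add_apply, Derivation.smul_apply, Derivation.leibniz, mul_one, mul_zero,
      add_zero, zero_add, map_zero, Derivation.map_one_eq_zero]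
    ring

/-- The section of `𝓔'(M)` with given components. -/
def csec (a1 a2 a3 b1 b2 b3 p q : A) : ConeGT A := (F.sec a1 a2 a3 b1 b2 b3, (p, q))

lemma exists_csec (X : ConeGT A) :
    ∃ a1 a2 a3 b1 b2 b3 p q, X = F.csec a1 a2 a3 b1 b2 b3 p q := by
  obtain ⟨a1, a2, a3, b1, b2, b3, h⟩ := F.exists_sec X.1
  exact ⟨a1, a2, a3, b1, b2, b3, X.2.1, X.2.2, Prod.ext h rfl⟩

lemma csec_inj {a1 a2 a3 b1 b2 b3 p q c1 c2 c3 d1 d2 d3 r s : A} :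
    F.csec a1 a2 a3 b1 b2 b3 p q = F.csec c1 c2 c3 d1 d2 d3 r s ↔
      a1 = c1 ∧ a2 = c2 ∧ a3 = c3 ∧ b1 = d1 ∧ b2 = d2 ∧ b3 = d3 ∧ p = r ∧ q = s := by
  simp only [csec, Prod.mk.injEq, F.sec_inj, and_assoc]

lemma csec_add (a1 a2 a3 b1 b2 b3 p q c1 c2 c3 d1 d2 d3 r s : A) :
    F.csec a1 a2 a3 b1 b2 b3 p q + F.csec c1 c2 c3 d1 d2 d3 r s =
      F.csec (a1 + c1) (a2 + c2) (a3 + c3) (b1 + d1) (b2 + d2) (b3 + d3) (p + r) (q + s) := by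
  simp only [csec, Prod.mk_add_mk, F.sec_add]

lemma csec_sub (a1 a2 a3 b1 b2 b3 p q c1 c2 c3 d1 d2 d3 r s : A) :
    F.csec a1 a2 a3 b1 b2 b3 p q - F.csec c1 c2 c3 d1 d2 d3 r s =
      F.csec (a1 - c1) (a2 - c2) (a3 - c3) (b1 - d1) (b2 - d2) (b3 - d3) (p - r) (q - s) := by
  simp only [csec, Prod.mk_sub_mk, F.sec_sub]

lemma csec_neg (a1 a2 a3 b1 b2 b3 p q : A) :
    -F.csec a1 a2 a3 b1 b2 b3 p q = F.csec (-a1) (-a2) (-a3) (-b1) (-b2) (-b3) (-p) (-q) := by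
  simp only [csec, Prod.neg_mk, F.sec_neg]

lemma csec_smul (h a1 a2 a3 b1 b2 b3 p q : A) :
    h • F.csec a1 a2 a3 b1 b2 b3 p q =
      F.csec (h * a1) (h * a2) (h * a3) (h * b1) (h * b2) (h * b3) (h * p) (h * q) := by
  simp only [csec, Prod.smul_mk, F.sec_smul, smul_eq_mul]

lemma csec_zero : F.csec 0 0 0 0 0 0 0 0 = 0 := by
  simp only [csec, sec_zero]; rfl

lemma two_mul_conePair_csec (a1 a2 a3 b1 b2 b3 p q c1 c2 c3 d1 d2 d3 r s : A) :
    2 * conePair (F.csec a1 a2 a3 b1 b2 b3 p q) (F.csec c1 c2 c3 d1 d2 d3 r s) =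
      b1 * c1 + b2 * c2 + b3 * c3 + (d1 * a1 + d2 * a2 + d3 * a3) + (p * s + r * q) := by
  simp only [conePair, csec, mul_add, two_mul_pair_sec, two_mul_half_smul]

lemma coneBracket_csec (a1 a2 a3 b1 b2 b3 p q c1 c2 c3 d1 d2 d3 r s : A) :
    coneBracket (F.csec a1 a2 a3 b1 b2 b3 p q) (F.csec c1 c2 c3 d1 d2 d3 r s) =
    F.csec
      (a1 * F.v1 c1 + a2 * F.v2 c1 + a3 * F.v3 c1 - (c1 * F.v1 a1 + c2 * F.v2 a1 + c3 * F.v3 a1)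
        + 2 * (a2 * c3 - a3 * c2))
      (a1 * F.v1 c2 + a2 * F.v2 c2 + a3 * F.v3 c2 - (c1 * F.v1 a2 + c2 * F.v2 a2 + c3 * F.v3 a2)
        + 2 * (a3 * c1 - a1 * c3))
      (a1 * F.v1 c3 + a2 * F.v2 c3 + a3 * F.v3 c3 - (c1 * F.v1 a3 + c2 * F.v2 a3 + c3 * F.v3 a3)
        + 2 * (a1 * c2 - a2 * c1))
      (a1 * F.v1 d1 + a2 * F.v2 d1 + a3 * F.v3 d1 - (c1 * F.v1 b1 + c2 * F.v2 b1 + c3 * F.v3 b1)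
        + 2 * (a2 * d3 - a3 * d2) - 2 * (c2 * b3 - c3 * b2)
        + (d1 * F.v1 a1 + d2 * F.v1 a2 + d3 * F.v1 a3)
        + (c1 * F.v1 b1 + c2 * F.v1 b2 + c3 * F.v1 b3) + (s * F.v1 p + r * F.v1 q))
      (a1 * F.v1 d2 + a2 * F.v2 d2 + a3 * F.v3 d2 - (c1 * F.v1 b2 + c2 * F.v2 b2 + c3 * F.v3 b2)
        + 2 * (a3 * d1 - a1 * d3) - 2 * (c3 * b1 - c1 * b3)
        + (d1 * F.v2 a1 + d2 * F.v2 a2 + d3 * F.v2 a3)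
        + (c1 * F.v2 b1 + c2 * F.v2 b2 + c3 * F.v2 b3) + (s * F.v2 p + r * F.v2 q))
      (a1 * F.v1 d3 + a2 * F.v2 d3 + a3 * F.v3 d3 - (c1 * F.v1 b3 + c2 * F.v2 b3 + c3 * F.v3 b3)
        + 2 * (a1 * d2 - a2 * d1) - 2 * (c1 * b2 - c2 * b1)
        + (d1 * F.v3 a1 + d2 * F.v3 a2 + d3 * F.v3 a3)
        + (c1 * F.v3 b1 + c2 * F.v3 b2 + c3 * F.v3 b3) + (s * F.v3 p + r * F.v3 q))
      (a1 * F.v1 r + a2 * F.v2 r + a3 * F.v3 r - (c1 * F.v1 p + c2 * F.v2 p + c3 * F.v3 p))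
      (a1 * F.v1 s + a2 * F.v2 s + a3 * F.v3 s - (c1 * F.v1 q + c2 * F.v2 q + c3 * F.v3 q)) := by
  simp only [coneBracket, csec, dorfman_sec, F.smul_diff_add_smul_diff, sec_add, vf_apply, add_zero]

end SU2Frame

end Frames

/-! ### Isotropic lines in a hyperbolic plane -/

section Isotropic

variable {A : Type*} [CommRing A] [Algebra ℝ A]

lemma eq_of_two_mul_eq {a b : A} (h : 2 * a = 2 * b) : a = b := by
  have h1 := congrArg (fun c => (1 / 2 : ℝ) • c) h
  have h2 : ∀ c : A, (1 / 2 : ℝ) • (2 * c) = c := fun c => by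
    rw [← mul_smul_comm, two_mul_half_smul]
  simpa only [h2] using h1

lemma two_mul_pair_add_smul (x y z : GT A) (a b : A) :
    2 * pair (a • x + b • y) z = a * (2 * pair x z) + b * (2 * pair y z) := by
  simp only [two_mul_pair, Prod.fst_add, Prod.snd_add, Prod.smul_fst, Prod.smul_snd,
    LinearMap.add_apply, LinearMap.smul_apply, map_add, map_smul, smul_eq_mul]
  ring

lemma pair_comm (x y : GT A) : pair x y = pair y x := by
  rw [pair, pair, add_comm]

/-- The functional `x ↦ 2 ⟨x, y⟩`. -/
def twoPair (y : GT A) : GT A →ₗ[A] A where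
  toFun x := 2 * pair x y
  map_add' x z := by simpa using two_mul_pair_add_smul x z y 1 1
  map_smul' a x := by simpa using two_mul_pair_add_smul x 0 y a 0

/-- The map `z ↦ 2⟨z, y⟩ x` is a projection onto the line, with kernel the orthogonal complement of
`y`. -/
lemma isSubbundle_span_singleton {x y : GT A} (h : 2 * pair x y = 1) :
    IsSubbundle (Submodule.span A {x}) := by
  refine ⟨LinearMap.ker (twoPair y), ?_⟩
  rw [isCompl_iff, Submodule.disjoint_def, codisjoint_iff, Submodule.eq_top_iff']
  have hx : ∀ a : A, twoPair y (a • x) = a := fun a => by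
    rw [map_smul, smul_eq_mul]
    change a * (2 * pair x y) = a
    rw [h, mul_one]
  constructor
  · intro z hz hz'
    obtain ⟨a, rfl⟩ := Submodule.mem_span_singleton.1 hz
    rw [LinearMap.mem_ker, hx] at hz'
    rw [hz', zero_smul]
  · intro z
    rw [← add_sub_cancel (twoPair y z • x) z]
    refine Submodule.add_mem_sup (Submodule.mem_span_singleton.2 ⟨_, rfl⟩) ?_
    rw [LinearMap.mem_ker, map_sub, hx, sub_self]

variable {x y : GT A}

lemma isIsotropicIn_span_singleton {E : Submodule A (GT A)} (hxE : x ∈ E)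
    (hx : 2 * pair x x = 0) (h : 2 * pair x y = 1) :
    IsIsotropicIn E (Submodule.span A {x}) := by
  refine ⟨isSubbundle_span_singleton h, by simpa using hxE, ?_⟩
  intro z hz w hw
  obtain ⟨a, rfl⟩ := Submodule.mem_span_singleton.1 hz
  obtain ⟨b, rfl⟩ := Submodule.mem_span_singleton.1 hw
  apply eq_of_two_mul_eq
  have h1 := two_mul_pair_add_smul x 0 (b • x) a 0
  have h2 := two_mul_pair_add_smul x 0 x b 0
  simp only [smul_zero, add_zero, zero_mul] at h1 h2
  rw [h1, pair_comm, h2, hx]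
  simp

lemma isMaxIsotropicIn_left (hx : 2 * pair x x = 0) (h : 2 * pair x y = 1) :
    IsMaxIsotropicIn (Submodule.span A {x, y}) (Submodule.span A {x}) := by
  refine ⟨isIsotropicIn_span_singleton (Submodule.subset_span (by simp)) hx h, ?_⟩
  intro l hl hle z hz
  obtain ⟨a, b, rfl⟩ := Submodule.mem_span_pair.1 (hl.2.1 hz)
  have h1 := congrArg (2 * ·) (hl.2.2 _ hz x (hle (Submodule.mem_span_singleton_self x)))
  simp only [two_mul_pair_add_smul, hx, pair_comm y x, h, mul_zero, mul_one, zero_add] at h1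
  rw [h1, zero_smul, add_zero]
  exact Submodule.mem_span_singleton.2 ⟨a, rfl⟩

lemma isMaxIsotropicIn_right (hy : 2 * pair y y = 0) (h : 2 * pair x y = 1) :
    IsMaxIsotropicIn (Submodule.span A {x, y}) (Submodule.span A {y}) := by
  rw [Set.pair_comm]
  exact isMaxIsotropicIn_left hy (by rwa [pair_comm])

/-- Over a connected manifold a hyperbolic plane has just two isotropic lines. -/
lemma eq_span_of_isMaxIsotropicIn (hA : ∀ a : A, a * a = a → a = 0 ∨ a = 1)
    (hx : 2 * pair x x = 0) (hy : 2 * pair y y = 0) (h : 2 * pair x y = 1)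
    {l : Submodule A (GT A)} (hl : IsMaxIsotropicIn (Submodule.span A {x, y}) l) :
    l = Submodule.span A {x} ∨ l = Submodule.span A {y} := by
  have h' : 2 * pair y x = 1 := by rwa [pair_comm]
  have key : l ≤ Submodule.span A {x} ∨ l ≤ Submodule.span A {y} := by
    obtain ⟨⟨⟨Q, hQ⟩, hle, hiso⟩, -⟩ := hl
    -- A direct summand is the image of a projection. With `P x = a x + c y` and `P y = b x + d y`,
    -- isotropy of the image and `P² = P` become polynomial relations among `a, b, c, d`.
    obtain ⟨P, hP, hPl⟩ : ∃ P : GT A →ₗ[A] GT A, (∀ z, P z ∈ l) ∧ ∀ z ∈ l, P z = z :=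
      ⟨l.subtype ∘ₗ Submodule.projectionOnto l Q hQ, fun z => by simp, fun z hz =>
        congrArg Subtype.val (Submodule.projectionOnto_apply_left hQ ⟨z, hz⟩)⟩
    obtain ⟨a, c, hac⟩ := Submodule.mem_span_pair.1 (hle (hP x))
    obtain ⟨b, d, hbd⟩ := Submodule.mem_span_pair.1 (hle (hP y))
    have hind : ∀ s t u v : A, s • x + t • y = u • x + v • y → s = u ∧ t = v := by
      intro s t u v hst
      have h1 := congrArg (fun z => 2 * pair z y) hst
      have h2 := congrArg (fun z => 2 * pair z x) hst
      simp only [two_mul_pair_add_smul, hx, hy, h, h', mul_one, mul_zero, add_zero,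
        zero_add] at h1 h2
      exact ⟨h1, h2⟩
    have hq : ∀ s t u v : A, 2 * pair (s • x + t • y) (u • x + v • y) = s * v + t * u := by
      intro s t u v
      rw [two_mul_pair_add_smul, pair_comm x, pair_comm y, two_mul_pair_add_smul,
        two_mul_pair_add_smul, hx, hy, h, h']
      ring
    have h1 : a * c = 0 := by
      have := congrArg (2 * ·) (hiso _ (hP x) _ (hP x))
      simp only [← hac, hq, mul_zero] at this
      exact eq_of_two_mul_eq (by linear_combination this)
    have h2 : b * d = 0 := by
      have := congrArg (2 * ·) (hiso _ (hP y) _ (hP y))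
      simp only [← hbd, hq, mul_zero] at this
      exact eq_of_two_mul_eq (by linear_combination this)
    have h3 : a * d + c * b = 0 := by
      have := congrArg (2 * ·) (hiso _ (hP x) _ (hP y))
      simpa only [← hac, ← hbd, hq, mul_zero] using this
    have hPP : ∀ s t : A, P (s • x + t • y) = (s * a + t * b) • x + (s * c + t * d) • y := by
      intro s t
      rw [map_add, map_smul, map_smul, ← hac, ← hbd]
      module
    obtain ⟨h4, h5⟩ := hind _ _ _ _ ((hPP a c).symm.trans ((congrArg P hac).trans
      ((hPl _ (hP x)).trans hac.symm)))
    obtain ⟨h6, h7⟩ := hind _ _ _ _ ((hPP b d).symm.trans ((congrArg P hbd).trans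
      ((hPl _ (hP y)).trans hbd.symm)))
    have h8 : b * c = 0 := by linear_combination c * h2 - b * h5 + b * h1
    have hz : ∀ z ∈ l, ∃ s t, z = (s * a + t * b) • x + (s * c + t * d) • y := by
      intro z hz
      obtain ⟨s, t, rfl⟩ := Submodule.mem_span_pair.1 (hle hz)
      exact ⟨s, t, by rw [← hPP, hPl _ hz]⟩
    have h9 : a * d = 0 := by linear_combination h3 - h8
    -- Since `b c = 0`, idempotence of `P` makes `a` idempotent, and connectedness leaves two cases:
    -- `a = 0` kills `b`, and `a = 1` kills `c` and `d`.
    rcases hA a (by linear_combination h4 - h8) with ha | ha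
    · right
      intro z hzl
      obtain ⟨s, t, rfl⟩ := hz z hzl
      have hb0 : b = 0 := by linear_combination -h6 + h2 + b * ha
      rw [ha, hb0, mul_zero, mul_zero, add_zero, zero_smul, zero_add]
      exact Submodule.mem_span_singleton.2 ⟨_, rfl⟩
    · left
      intro z hzl
      obtain ⟨s, t, rfl⟩ := hz z hzl
      have hc0 : c = 0 := by linear_combination h1 - c * ha
      have hd0 : d = 0 := by linear_combination h9 - d * ha
      rw [hc0, hd0, mul_zero, mul_zero, add_zero, zero_smul, add_zero]
      exact Submodule.mem_span_singleton.2 ⟨_, rfl⟩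
  rcases key with hk | hk
  · exact Or.inl (le_antisymm hk (hl.2 (isIsotropicIn_span_singleton
      (Submodule.subset_span (by simp)) hx h) hk))
  · exact Or.inr (le_antisymm hk (hl.2 (isIsotropicIn_span_singleton
      (Submodule.subset_span (by simp)) hy h') hk))

end Isotropic

/-! ### The structure `(E, L)` of the block matrix -/

namespace SU2Frame

variable {A : Type*} [CommRing A] [Algebra ℝ A] (F : SU2Frame A)

/-- The endomorphism `[[j, Λ], [0, -j*]]` in components. -/
def IsBlock (f g : A) (J : ConeGT A →ₗ[A] ConeGT A) : Prop :=
  ∀ a1 a2 a3 b1 b2 b3 p q, J (F.csec a1 a2 a3 b1 b2 b3 p q) =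
    F.csec (-p - g * b2 + f * b3) (-a3 - f * q + g * b1) (a2 - g * q - f * b1) (-q) (-b3) b2
      (a1 + f * b2 + g * b3) b1

lemma eulerT_eq : (eulerT : ConeGT A) = F.csec 0 0 0 0 0 0 1 0 := by
  rw [csec, sec_zero]; rfl

lemma dT_eq : (dT : ConeGT A) = F.csec 0 0 0 0 0 0 0 1 := by
  rw [csec, sec_zero]; rfl

variable {F} {f g : A} {J : ConeGT A →ₗ[A] ConeGT A}

namespace IsBlock

lemma isSek0 (hJ : F.IsBlock f g J) : IsSek0 J where
  sq X := by
    obtain ⟨a1, a2, a3, b1, b2, b3, p, q, rfl⟩ := F.exists_csec X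
    rw [hJ, hJ, csec_neg, csec_inj]
    refine ⟨?_, ?_, ?_, ?_, ?_, ?_, ?_, ?_⟩ <;> ring
  skew X Y := by
    obtain ⟨a1, a2, a3, b1, b2, b3, p, q, rfl⟩ := F.exists_csec X
    obtain ⟨c1, c2, c3, d1, d2, d3, r, s, rfl⟩ := F.exists_csec Y
    apply eq_of_two_mul_eq
    rw [mul_neg, hJ, hJ, two_mul_conePair_csec, two_mul_conePair_csec]
    ring
  euler_mem := by
    rw [F.eulerT_eq, hJ]
    simp [csec]
  dT_mem := by
    rw [F.dT_eq, hJ]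
    simp [csec]

lemma tripleE1_eq (hJ : F.IsBlock f g J) : tripleE1 J = F.sec (-1) 0 0 0 0 0 := by
  rw [tripleE1, F.eulerT_eq, hJ]
  simp [csec]

lemma tripleE2_eq (hJ : F.IsBlock f g J) : tripleE2 J = F.sec 0 (-f) (-g) (-1) 0 0 := by
  rw [tripleE2, F.dT_eq, hJ]
  simp [csec]

lemma tripleΦ_sec (hJ : F.IsBlock f g J) (a1 a2 a3 b1 b2 b3 : A) :
    tripleΦ J (F.sec a1 a2 a3 b1 b2 b3) =
      F.sec (-(g * b2) + f * b3) (-a3 + g * b1) (a2 - f * b1) 0 (-b3) b2 := by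
  have h := congrArg Prod.fst (hJ a1 a2 a3 b1 b2 b3 0 0)
  refine Eq.trans h ?_
  simp [csec]

lemma pair_e1_e1 (hJ : F.IsBlock f g J) : 2 * pair (tripleE1 J) (tripleE1 J) = 0 := by
  rw [hJ.tripleE1_eq, two_mul_pair_sec]; ring

lemma pair_e2_e2 (hJ : F.IsBlock f g J) : 2 * pair (tripleE2 J) (tripleE2 J) = 0 := by
  rw [hJ.tripleE2_eq, two_mul_pair_sec]; ring

lemma pair_e1_e2 (hJ : F.IsBlock f g J) : 2 * pair (tripleE1 J) (tripleE2 J) = 1 := by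
  rw [hJ.tripleE1_eq, hJ.tripleE2_eq, two_mul_pair_sec]; ring

/-- The complex numbers `a2 + i a3` and `b2 + i b3` are the coordinates with respect to the
generators `V₂ - i V₃` and `ν₂ - i ν₃ - (f - i g) V₁`. -/
lemma mem_bundleL (hJ : F.IsBlock f g J) {z : GTC A} : z ∈ bundleL J ↔ ∃ a2 a3 b2 b3,
    z = (F.sec (-(f * b2) - g * b3) a2 a3 0 b2 b3,
      F.sec (g * b2 - f * b3) a3 (-a2) 0 b3 (-b2)) := by
  constructor
  · rintro ⟨h1, h2⟩
    obtain ⟨z1, z2⟩ := z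
    obtain ⟨a1, a2, a3, b1, b2, b3, rfl⟩ := F.exists_sec z1
    obtain ⟨c1, c2, c3, d1, d2, d3, rfl⟩ := F.exists_sec z2
    simp only [hJ.tripleΦ_sec, sec_neg, sec_inj] at h1 h2
    obtain ⟨h11, h12, h13, h14, h15, h16⟩ := h1
    obtain ⟨h21, h22, h23, h24, h25, h26⟩ := h2
    refine ⟨a2, a3, b2, b3, ?_⟩
    rw [Prod.mk.injEq, sec_inj, sec_inj]
    refine ⟨⟨?_, rfl, rfl, ?_, rfl, rfl⟩, ?_, ?_, ?_, ?_, ?_, ?_⟩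
    · linear_combination -h21 - g * h26 + f * h16
    · exact h24.symm
    · linear_combination h11
    · linear_combination h12 + g * h24
    · linear_combination h13 - f * h24
    · linear_combination h14
    · linear_combination h15
    · linear_combination h16
  · rintro ⟨a2, a3, b2, b3, rfl⟩
    constructor
    · simp only [hJ.tripleΦ_sec, sec_neg, sec_inj]
      refine ⟨?_, ?_, ?_, ?_, ?_, ?_⟩ <;> first | trivial | ring
    · simp only [hJ.tripleΦ_sec, sec_inj]
      refine ⟨?_, ?_, ?_, ?_, ?_, ?_⟩ <;> first | trivial | ring

lemma mem_sup_e1 (hJ : F.IsBlock f g J) {z : GTC A} :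
    z ∈ bundleL J ⊔ complexify (Submodule.span A {tripleE1 J}) ↔ ∃ s t a2 a3 b2 b3,
      z = (F.sec s a2 a3 0 b2 b3, F.sec t a3 (-a2) 0 b3 (-b2)) := by
  rw [Submodule.mem_sup, hJ.tripleE1_eq]
  constructor
  · rintro ⟨y, hy, ⟨w1, w2⟩, ⟨hw1, hw2⟩, rfl⟩
    obtain ⟨a2, a3, b2, b3, rfl⟩ := hJ.mem_bundleL.1 hy
    obtain ⟨s, rfl⟩ := Submodule.mem_span_singleton.1 hw1
    obtain ⟨t, rfl⟩ := Submodule.mem_span_singleton.1 hw2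
    refine ⟨-(f * b2) - g * b3 + s * -1, g * b2 - f * b3 + t * -1, a2, a3, b2, b3, ?_⟩
    simp only [sec_smul, Prod.mk_add_mk, sec_add, mul_zero, add_zero]
  · rintro ⟨s, t, a2, a3, b2, b3, rfl⟩
    refine ⟨_, hJ.mem_bundleL.2 ⟨a2, a3, b2, b3, rfl⟩,
      ((-f * b2 - g * b3 - s) • F.sec (-1) 0 0 0 0 0, (g * b2 - f * b3 - t) • F.sec (-1) 0 0 0 0 0),
      ⟨Submodule.smul_mem _ _ (Submodule.mem_span_singleton_self _),
        Submodule.smul_mem _ _ (Submodule.mem_span_singleton_self _)⟩, ?_⟩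
    simp only [sec_smul, Prod.mk_add_mk, sec_add, mul_zero, add_zero, Prod.mk.injEq, sec_inj,
      and_self, and_true]
    constructor <;> ring

lemma mem_sup_e2 (hJ : F.IsBlock f g J) {z : GTC A} :
    z ∈ bundleL J ⊔ complexify (Submodule.span A {tripleE2 J}) ↔ ∃ s t a2 a3 b2 b3,
      z = (F.sec (-(f * b2) - g * b3) (a2 + f * s) (a3 + g * s) s b2 b3,
      F.sec (g * b2 - f * b3) (a3 + f * t) (-a2 + g * t) t b3 (-b2)) := by
  rw [Submodule.mem_sup, hJ.tripleE2_eq]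
  constructor
  · rintro ⟨y, hy, ⟨w1, w2⟩, ⟨hw1, hw2⟩, rfl⟩
    obtain ⟨a2, a3, b2, b3, rfl⟩ := hJ.mem_bundleL.1 hy
    obtain ⟨s, rfl⟩ := Submodule.mem_span_singleton.1 hw1
    obtain ⟨t, rfl⟩ := Submodule.mem_span_singleton.1 hw2
    refine ⟨-s, -t, a2, a3, b2, b3, ?_⟩
    simp only [sec_smul, Prod.mk_add_mk, sec_add, Prod.mk.injEq, sec_inj]
    refine ⟨⟨?_, ?_, ?_, ?_, ?_, ?_⟩, ?_, ?_, ?_, ?_, ?_, ?_⟩ <;> ring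
  · rintro ⟨s, t, a2, a3, b2, b3, rfl⟩
    refine ⟨_, hJ.mem_bundleL.2 ⟨a2, a3, b2, b3, rfl⟩,
      ((-s) • F.sec 0 (-f) (-g) (-1) 0 0, (-t) • F.sec 0 (-f) (-g) (-1) 0 0),
      ⟨Submodule.smul_mem _ _ (Submodule.mem_span_singleton_self _),
        Submodule.smul_mem _ _ (Submodule.mem_span_singleton_self _)⟩, ?_⟩
    simp only [sec_smul, Prod.mk_add_mk, sec_add, Prod.mk.injEq, sec_inj]
    refine ⟨⟨?_, ?_, ?_, ?_, ?_, ?_⟩, ?_, ?_, ?_, ?_, ?_, ?_⟩ <;> ring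

/-- Adding `V₁` absorbs the `V₁`-part of the generators of `L`, so `f` and `g` disappear and no
condition on them arises. -/
lemma isInvolutive_sup_e1 (hJ : F.IsBlock f g J) :
    IsInvolutive (bundleL J ⊔ complexify (Submodule.span A {tripleE1 J})) := by
  intro z hz w hw
  obtain ⟨s, t, a2, a3, b2, b3, rfl⟩ := hJ.mem_sup_e1.1 hz
  obtain ⟨u, v, c2, c3, d2, d3, rfl⟩ := hJ.mem_sup_e1.1 hw
  rw [hJ.mem_sup_e1]
  simp only [dorfmanC, dorfman_sec, sec_sub, sec_add, Prod.mk.injEq, sec_inj]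
  refine ⟨_, _, _, _, _, _, ⟨rfl, rfl, rfl, ?_, rfl, rfl⟩, rfl, ?_, ?_, ?_, ?_, ?_⟩ <;>
  · simp only [map_neg, map_zero]
    ring

/-- The bracket of the two generators has `V₁`-coefficient `-(V₂ - i V₃)(f - i g)`; its real and
imaginary parts are the two equations. -/
lemma isInvolutive_bundleL_iff (hJ : F.IsBlock f g J) :
    IsInvolutive (bundleL J) ↔ F.v2 g + F.v3 f = 0 ∧ F.v2 f - F.v3 g = 0 := by
  constructor
  · intro h
    have h1 := h _ (hJ.mem_bundleL.2 ⟨1, 0, 0, 0, rfl⟩) _ (hJ.mem_bundleL.2 ⟨0, 0, 1, 0, rfl⟩)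
    obtain ⟨a2, a3, b2, b3, h2⟩ := hJ.mem_bundleL.1 h1
    simp only [dorfmanC, dorfman_sec, sec_sub, sec_add, Prod.mk.injEq, sec_inj, map_neg, map_zero,
      Derivation.map_one_eq_zero, mul_zero, mul_one, sub_zero, zero_sub, neg_zero, zero_mul,
      one_mul, add_zero, zero_add, neg_neg, sub_self] at h2
    obtain ⟨⟨h3, -, -, -, hb2, hb3⟩, h4, -⟩ := h2
    constructor
    · linear_combination h4 - g * hb2 + f * hb3
    · linear_combination -h3 - f * hb2 - g * hb3
  · rintro ⟨h1, h2⟩ z hz w hw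
    have h3 : F.v3 f = -F.v2 g := by linear_combination h1
    have h4 : F.v3 g = F.v2 f := by linear_combination -h2
    obtain ⟨a2, a3, b2, b3, rfl⟩ := hJ.mem_bundleL.1 hz
    obtain ⟨c2, c3, d2, d3, rfl⟩ := hJ.mem_bundleL.1 hw
    rw [hJ.mem_bundleL]
    simp only [dorfmanC, dorfman_sec, sec_sub, sec_add, Prod.mk.injEq, sec_inj]
    refine ⟨_, _, _, _, ⟨?_, rfl, rfl, ?_, rfl, rfl⟩, ?_, ?_, ?_, ?_, ?_, ?_⟩ <;>
    · simp only [map_neg, map_zero, map_sub, Derivation.leibniz, smul_eq_mul, h3, h4]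
      ring

lemma isInvolutive_sup_e2 (hJ : F.IsBlock f g J) (h1 : F.v2 g + F.v3 f = 0)
    (h2 : F.v2 f - F.v3 g = 0) :
    IsInvolutive (bundleL J ⊔ complexify (Submodule.span A {tripleE2 J})) := by
  have h3 : F.v3 f = -F.v2 g := by linear_combination h1
  have h4 : F.v3 g = F.v2 f := by linear_combination -h2
  intro z hz w hw
  obtain ⟨s, t, a2, a3, b2, b3, rfl⟩ := hJ.mem_sup_e2.1 hz
  obtain ⟨u, v, c2, c3, d2, d3, rfl⟩ := hJ.mem_sup_e2.1 hw
  rw [hJ.mem_sup_e2]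
  simp only [dorfmanC, dorfman_sec, sec_sub, sec_add, Prod.mk.injEq, sec_inj]
  -- The `ν₁`-coefficient of the bracket fixes the multiple of `e₂`; its `V₂`- and `V₃`-parts are
  -- subtracted to find the coordinates in `L`.
  refine ⟨_, _, _, _, _, _, ⟨?_, (sub_add_cancel _ (f * _)).symm, (sub_add_cancel _ (g * _)).symm,
    rfl, rfl, rfl⟩, ?_, ?_, ?_, rfl, ?_, ?_⟩ <;>
  · simp only [map_neg, map_sub, map_add, Derivation.leibniz, smul_eq_mul, h3, h4]
    ring

lemma isIntegrableJ (hJ : F.IsBlock f g J) (h1 : F.v2 g + F.v3 f = 0)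
    (h2 : F.v2 f - F.v3 g = 0) (h3 : F.v1 g + 2 * f = 0) (h4 : F.v1 f - 2 * g = 0) :
    IsIntegrableJ J := by
  have h5 : F.v3 f = -F.v2 g := by linear_combination h1
  have h6 : F.v3 g = F.v2 f := by linear_combination -h2
  have h7 : F.v1 g = -(2 * f) := by linear_combination h3
  have h8 : F.v1 f = 2 * g := by linear_combination h4
  intro X Y
  obtain ⟨a1, a2, a3, b1, b2, b3, p, q, rfl⟩ := F.exists_csec X
  obtain ⟨c1, c2, c3, d1, d2, d3, r, s, rfl⟩ := F.exists_csec Y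
  rw [hJ, hJ, coneBracket_csec, coneBracket_csec, coneBracket_csec, coneBracket_csec, csec_add,
    hJ, csec_sub, csec_sub, ← F.csec_zero, csec_inj]
  refine ⟨?_, ?_, ?_, ?_, ?_, ?_, ?_, ?_⟩ <;>
  · simp only [map_neg, map_sub, map_add, Derivation.leibniz, smul_eq_mul, h5, h6, h7, h8]
    ring

end IsBlock

end SU2Frame

/-! ### Arbitrary elements of `Sek₀(M)` -/

section Representatives

variable {A : Type*} [CommRing A] [Algebra ℝ A] {J : ConeGT A →ₗ[A] ConeGT A}

namespace IsSek0

lemma apply_inr (hs : IsSek0 J) (p q : A) :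
    J (0, (p, q)) = (p • tripleE1 J + q • tripleE2 J, 0) := by
  have h : ((0, (p, q)) : ConeGT A) = p • eulerT + q • dT := by
    simp [eulerT, dT]
  rw [h, map_add, map_smul, map_smul]
  refine Prod.ext rfl ?_
  simp [hs.euler_mem, hs.dT_mem]

lemma injective (hs : IsSek0 J) {X Y : ConeGT A} (h : J X = J Y) : X = Y := by
  rw [← neg_inj, ← hs.sq, ← hs.sq, h]

/-- By skewness `⟨J x, ∂ₜ⟩ = -⟨x, e₁⟩` and `⟨J x, dt⟩ = -⟨x, e₂⟩`, and these products detect the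
`dt`- and `∂ₜ`-components of `J x`. -/
lemma apply_inl_of_pair_eq_zero (hs : IsSek0 J) {x : GT A} (h1 : 2 * pair x (tripleE1 J) = 0)
    (h2 : 2 * pair x (tripleE2 J) = 0) : J (x, 0) = (tripleΦ J x, 0) := by
  have hpair : ∀ y : GT A, 2 * pair y 0 = 0 := fun y => by simp [two_mul_pair]
  have h3 := congrArg (2 * ·) (hs.skew (x, 0) eulerT)
  have h4 := congrArg (2 * ·) (hs.skew (x, 0) dT)
  simp only [conePair, mul_neg, mul_add, two_mul_half_smul, hs.euler_mem, hs.dT_mem] at h3 h4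
  change 2 * pair _ 0 + (_ * 0 + 1 * _) = -(2 * pair x (tripleE1 J) + (0 * 0 + 0 * 0)) at h3
  change 2 * pair _ 0 + (_ * 1 + 0 * _) = -(2 * pair x (tripleE2 J) + (0 * 0 + 0 * 0)) at h4
  rw [hpair, h1] at h3
  rw [hpair, h2] at h4
  refine Prod.ext rfl (Prod.ext ?_ ?_)
  · simpa using h4
  · simpa using h3

/-- `J` maps `E` into `span(∂ₜ, dt)`. -/
lemma exists_apply_inl_of_mem (hs : IsSek0 J) {x : GT A} (hx : x ∈ bundleE J) :
    ∃ p q, J (x, 0) = (0, (p, q)) := by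
  obtain ⟨p, q, rfl⟩ := Submodule.mem_span_pair.1 hx
  refine ⟨-p, -q, ?_⟩
  rw [← hs.apply_inr, hs.sq]
  simp

end IsSek0

end Representatives

/-! ### Normality and strong integrability -/

namespace SU2Frame

variable {A : Type*} [CommRing A] [Algebra ℝ A] {F : SU2Frame A} {f g : A}
  {J : ConeGT A →ₗ[A] ConeGT A}

namespace IsBlock

/-- An element of `Sek₀(M)` representing `(E, L)` agrees with `J` on `E^⊥`. -/
lemma apply_inl_of_mem_bundleL (hJ : F.IsBlock f g J) {K : ConeGT A →ₗ[A] ConeGT A}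
    (hs : IsSek0 K) (hE : bundleE K = bundleE J) (hL : bundleL K = bundleL J) {z : GTC A}
    (hz : z ∈ bundleL J) : K (z.1, 0) = (-z.2, 0) ∧ K (z.2, 0) = (z.1, 0) := by
  have hperp : ∀ e ∈ bundleE J, 2 * pair z.1 e = 0 ∧ 2 * pair z.2 e = 0 := by
    intro e he
    obtain ⟨a2, a3, b2, b3, rfl⟩ := hJ.mem_bundleL.1 hz
    obtain ⟨s, t, rfl⟩ := Submodule.mem_span_pair.1 he
    rw [hJ.tripleE1_eq, hJ.tripleE2_eq, sec_smul, sec_smul, sec_add, two_mul_pair_sec,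
      two_mul_pair_sec]
    constructor <;> ring
  have h1 := hperp (tripleE1 K) (hE ▸ Submodule.subset_span (by simp))
  have h2 := hperp (tripleE2 K) (hE ▸ Submodule.subset_span (by simp))
  rw [← hL] at hz
  rw [hs.apply_inl_of_pair_eq_zero h1.1 h2.1, hs.apply_inl_of_pair_eq_zero h1.2 h2.2, hz.1, hz.2]
  exact ⟨rfl, rfl⟩

/-- `K` is known on `E^⊥`; on `E` only `K e₁ = p ∂ₜ + q dt` and `K e₂ = r ∂ₜ + s dt` with unknown
functions, where `e₁, e₂` belong to `J`. The Nijenhuis tensor is evaluated on `(V₂, e₁)`, on `(V₂,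
ν₂ - f V₁)` and on `(e₁, e₂)`: the first shows that `p, q` have zero derivatives, the second gives
the equations along `V₂, V₃`, the third those along `V₁`. -/
lemma equations_of_isIntegrableJ (hJ : F.IsBlock f g J) {K : ConeGT A →ₗ[A] ConeGT A}
    (hs : IsSek0 K) (hE : bundleE K = bundleE J) (hL : bundleL K = bundleL J)
    (hK : IsIntegrableJ K) :
    (F.v2 g + F.v3 f = 0 ∧ F.v2 f - F.v3 g = 0) ∧
      (F.v1 g + 2 * f = 0 ∧ F.v1 f - 2 * g = 0) := by
  have hcs : ∀ a1 a2 a3 b1 b2 b3 : A,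
      ((F.sec a1 a2 a3 b1 b2 b3, 0) : ConeGT A) = F.csec a1 a2 a3 b1 b2 b3 0 0 := fun _ _ _ _ _ _ =>
    rfl
  have hct : ∀ p q : A, ((0, (p, q)) : ConeGT A) = F.csec 0 0 0 0 0 0 p q := fun p q => by
    rw [csec, sec_zero]
  -- values of `K` on the frame of `E^⊥`
  obtain ⟨k3, k2⟩ := hJ.apply_inl_of_mem_bundleL hs hE hL (hJ.mem_bundleL.2 ⟨1, 0, 0, 0, rfl⟩)
  obtain ⟨kw, -⟩ := hJ.apply_inl_of_mem_bundleL hs hE hL (hJ.mem_bundleL.2 ⟨0, 0, 1, 0, rfl⟩)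
  simp only [mul_zero, sub_zero, neg_zero, mul_one, sec_neg, hcs, neg_neg] at k3 k2 kw
  -- values of `K` on `E`
  obtain ⟨p, q, k1⟩ := hs.exists_apply_inl_of_mem (x := tripleE1 J)
    (hE ▸ Submodule.subset_span (by simp))
  obtain ⟨r, s, ke⟩ := hs.exists_apply_inl_of_mem (x := tripleE2 J)
    (hE ▸ Submodule.subset_span (by simp))
  rw [hJ.tripleE1_eq, hcs, hct] at k1
  rw [hJ.tripleE2_eq, hcs, hct] at ke
  have hker : ∀ u v : A, K (F.csec 0 0 0 0 0 0 u v) = 0 → u = 0 ∧ v = 0 := by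
    intro u v h
    have h1 := hs.injective (h.trans (map_zero K).symm)
    rw [← F.csec_zero, csec_inj] at h1
    exact ⟨h1.2.2.2.2.2.2.1, h1.2.2.2.2.2.2.2⟩
  have hvert : ∀ u v : A, ∃ a b, K (F.csec 0 0 0 0 0 0 u v) =
      F.csec (-a) (-(b * f)) (-(b * g)) (-b) 0 0 0 0 := by
    intro u v
    rw [← hct, hs.apply_inr]
    have hmem : u • tripleE1 K + v • tripleE2 K ∈ bundleE J :=
      hE ▸ Submodule.mem_span_pair.2 ⟨u, v, rfl⟩
    obtain ⟨a, b, hab⟩ := Submodule.mem_span_pair.1 hmem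
    refine ⟨a, b, ?_⟩
    rw [← hab, hJ.tripleE1_eq, hJ.tripleE2_eq, sec_smul, sec_smul, sec_add, hcs]
    simp only [mul_zero, mul_neg, mul_one, zero_add, add_zero]
  have hvec : ∀ x1 x2 x3 u v : A, K (F.csec x1 x2 x3 0 0 0 u v) =
      F.csec 0 (-x3) x2 0 0 0 (-x1 * p) (-x1 * q) + K (F.csec 0 0 0 0 0 0 u v) := by
    intro x1 x2 x3 u v
    have h : F.csec x1 x2 x3 0 0 0 u v = (-x1) • F.csec (-1) 0 0 0 0 0 0 0 +
        x2 • F.csec 0 1 0 0 0 0 0 0 + (-x3) • F.csec 0 0 (-1) 0 0 0 0 0 +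
        F.csec 0 0 0 0 0 0 u v := by
      simp only [csec_smul, csec_add, csec_inj]
      refine ⟨?_, ?_, ?_, ?_, ?_, ?_, ?_, ?_⟩ <;> ring
    rw [h, map_add, map_add, map_add, map_smul, map_smul, map_smul, k1, k2, k3]
    simp only [csec_smul, csec_add]
    congr 1
    rw [csec_inj]
    refine ⟨?_, ?_, ?_, ?_, ?_, ?_, ?_, ?_⟩ <;> ring
  -- `p` and `q` are constant
  have hA := hK (F.csec 0 1 0 0 0 0 0 0) (F.csec (-1) 0 0 0 0 0 0 0)
  rw [k1, k3] at hA
  simp only [coneBracket_csec, csec_add, csec_sub, map_neg, map_zero, Derivation.map_one_eq_zero,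
    mul_zero, zero_mul, mul_one, one_mul, neg_zero, add_zero, zero_add, sub_zero, zero_sub,
    sub_self, mul_neg, neg_neg] at hA
  rw [hvec] at hA
  -- The `V₃`-derivatives form the `∂ₜ, dt` part, while the `V₂`-derivatives enter through a value
  -- of `K` in `E`; the two parts vanish separately, and `K` is injective.
  obtain ⟨hp3, hq3, hp2, hq2⟩ : F.v3 p = 0 ∧ F.v3 q = 0 ∧ F.v2 p = 0 ∧ F.v2 q = 0 := by
    obtain ⟨a, b, hab⟩ := hvert (F.v2 p) (F.v2 q)
    have hA' := hA
    rw [hab, csec_add, csec_sub, ← F.csec_zero, csec_inj] at hA'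
    obtain ⟨ha, -, -, hb, -, -, hp, hq⟩ := hA'
    have ha0 : a = 0 := by linear_combination ha
    have hb0 : b = 0 := by linear_combination hb
    rw [ha0, hb0, zero_mul, zero_mul, neg_zero, csec_zero] at hab
    exact ⟨by linear_combination hp, by linear_combination hq, hker _ _ hab⟩
  -- `V₂` and `V₃` are bracket generating: `2V₁ = [V₂, V₃]`.
  have hconst : ∀ h : A, F.v2 h = 0 → F.v3 h = 0 → F.v1 h = 0 := by
    intro h h2 h3
    apply eq_of_two_mul_eq
    have h4 := congrArg (fun X : VF A => X h) F.lie23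
    simpa [Derivation.commutator_apply, h2, h3] using h4.symm
  have hp1 := hconst p hp2 hp3
  have hq1 := hconst q hq2 hq3
  have hB := hK (F.csec 0 1 0 0 0 0 0 0) (F.csec (-f) 0 0 0 1 0 0 0)
  rw [k3, kw] at hB
  simp only [coneBracket_csec, csec_add, csec_sub, map_neg, map_zero, Derivation.map_one_eq_zero,
    mul_zero, zero_mul, mul_one, one_mul, neg_zero, add_zero, zero_add, sub_zero, zero_sub,
    sub_self, mul_neg, neg_neg] at hB
  -- The `ν₁`-parts of `𝓛_{V₃} ν₂` and `𝓛_{V₂} ν₃` cancel, leaving no 1-form under `K`.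
  rw [neg_add_cancel, hvec, csec_zero, map_zero, add_zero, csec_sub, ← F.csec_zero, csec_inj] at hB
  have hC := hK (F.csec (-1) 0 0 0 0 0 0 0) (F.csec 0 (-f) (-g) (-1) 0 0 0 0)
  rw [k1, ke] at hC
  simp only [coneBracket_csec, csec_add, csec_sub, map_neg, map_zero, Derivation.map_one_eq_zero,
    mul_zero, zero_mul, mul_one, neg_zero, add_zero, zero_add, sub_zero, zero_sub,
    sub_self, mul_neg, neg_neg] at hC
  refine ⟨⟨?_, ?_⟩, ?_⟩
  -- Only the products of this function with `p` and `q` are known to vanish; injectivity of `K`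
  -- removes the factors.
  · have h1 : K ((F.v2 g + F.v3 f) • F.csec (-1) 0 0 0 0 0 0 0) = 0 := by
      rw [map_smul, k1, csec_smul, ← F.csec_zero, csec_inj]
      refine ⟨?_, ?_, ?_, ?_, ?_, ?_, ?_, ?_⟩ <;> try exact mul_zero _
      · linear_combination -hB.2.2.2.2.2.2.1
      · linear_combination -hB.2.2.2.2.2.2.2
    have h2 := hs.injective (h1.trans (map_zero K).symm)
    rw [csec_smul, ← F.csec_zero, csec_inj] at h2
    linear_combination -h2.1
  · linear_combination hB.1
  -- The derivatives of `r, s` contribute an unknown section of `E`. Its `ν₁`-component must vanish,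
  -- and with it the multiple of `e₂`, so the `V₂`- and `V₃`-components give the equations.
  · obtain ⟨a, b, hab⟩ := hvert (-1 * F.v1 r) (-1 * F.v1 s)
    simp only [hp1, hp2, hp3, hq1, hq2, hq3, mul_zero, add_zero, neg_zero, zero_add, hab,
      csec_sub] at hC
    rw [← F.csec_zero, csec_inj] at hC
    obtain ⟨-, h2, h3, h4, -⟩ := hC
    constructor
    · linear_combination -h3 + g * h4
    · linear_combination -h2 + f * h4

lemma isNormal_iff (hJ : F.IsBlock f g J) : IsNormal (bundleE J) (bundleL J) ↔
    (F.v2 g + F.v3 f = 0 ∧ F.v2 f - F.v3 g = 0) ∧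
      (F.v1 g + 2 * f = 0 ∧ F.v1 f - 2 * g = 0) := by
  constructor
  · rintro ⟨K, hs, hE, hL, hK⟩
    exact hJ.equations_of_isIntegrableJ hs hE hL hK
  · rintro ⟨⟨h1, h2⟩, h3, h4⟩
    exact ⟨J, hJ.isSek0, rfl, rfl, hJ.isIntegrableJ h1 h2 h3 h4⟩

lemma isNormalTriple_iff (hJ : F.IsBlock f g J) :
    IsNormalTriple (tripleΦ J) (tripleE1 J) (tripleE2 J) ↔
    (F.v2 g + F.v3 f = 0 ∧ F.v2 f - F.v3 g = 0) ∧
      (F.v1 g + 2 * f = 0 ∧ F.v1 f - 2 * g = 0) := by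
  constructor
  · rintro ⟨K, hs, hΦ, h1, h2, hK⟩
    exact hJ.equations_of_isIntegrableJ hs (by rw [bundleE, bundleE, h1, h2])
      (by rw [bundleL, bundleL, hΦ]) hK
  · rintro ⟨⟨h1, h2⟩, h3, h4⟩
    exact ⟨J, hJ.isSek0, rfl, rfl, rfl, hJ.isIntegrableJ h1 h2 h3 h4⟩

lemma isIntegrable (hJ : F.IsBlock f g J) : IsIntegrable (bundleE J) (bundleL J) :=
  ⟨_, isMaxIsotropicIn_left hJ.pair_e1_e1 hJ.pair_e1_e2, hJ.isInvolutive_sup_e1⟩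

/-- Forward, `L` is the intersection of `L ⊕ e₁` and `L ⊕ e₂`, both involutive. Conversely, these
are the only sums to check, because the hypothesis on idempotents leaves two maximal isotropic
lines. -/
lemma isStronglyIntegrable_iff (hA : ∀ a : A, a * a = a → a = 0 ∨ a = 1)
    (hJ : F.IsBlock f g J) :
    IsStronglyIntegrable (bundleE J) (bundleL J) ↔ IsInvolutive (bundleL J) := by
  constructor
  · intro h z hz w hw
    have h1 := hJ.isInvolutive_sup_e1 z (Submodule.mem_sup_left hz) w (Submodule.mem_sup_left hw)
    have h2 := h _ (isMaxIsotropicIn_right hJ.pair_e2_e2 hJ.pair_e1_e2)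
      z (Submodule.mem_sup_left hz) w (Submodule.mem_sup_left hw)
    obtain ⟨s, t, a2, a3, b2, b3, h3⟩ := hJ.mem_sup_e1.1 h1
    obtain ⟨u, v, c2, c3, d2, d3, h4⟩ := hJ.mem_sup_e2.1 h2
    rw [h3] at h4 ⊢
    simp only [Prod.mk.injEq, sec_inj] at h4
    obtain ⟨⟨k1, k2, k3, k4, k5, k6⟩, l1, l2, l3, l4, -⟩ := h4
    refine hJ.mem_bundleL.2 ⟨a2, a3, b2, b3, ?_⟩
    rw [k1, l1, k5, k6]
  · intro h l hl
    obtain ⟨h1, h2⟩ := hJ.isInvolutive_bundleL_iff.1 h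
    rcases eq_span_of_isMaxIsotropicIn hA hJ.pair_e1_e1 hJ.pair_e2_e2 hJ.pair_e1_e2 hl with
      rfl | rfl
    · exact hJ.isInvolutive_sup_e1
    · exact hJ.isInvolutive_sup_e2 h1 h2

end IsBlock

end SU2Frame

/-! ### The frame of `S³` and the components of `sphereJ` -/

section SphereFrame

lemma derivation_ext_coord {D D' : VF CS3} (h : ∀ k, D (coord k) = D' (coord k)) : D = D' := by
  rw [← sub_eq_zero]
  exact derivation_eq_zero_of_coord _ fun k => by simp [h]

lemma sphereVF_coord (a : UnitField) (k : Fin 4) :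
    sphereVF a (coord k) = coordFun a.toLin k := by
  ext x
  change deriv (fun t : ℝ => Real.cos t * (x : R4) k + Real.sin t * a.toLin x k) 0 = a.toLin x k
  have h1 := (Real.hasDerivAt_cos 0).mul_const ((x : R4) k)
  have h2 := (Real.hasDerivAt_sin 0).mul_const (a.toLin x k)
  refine (h1.add h2).deriv.trans ?_
  simp

lemma sum_coord_sq : coord 0 * coord 0 + coord 1 * coord 1 + coord 2 * coord 2 +
    coord 3 * coord 3 = 1 := by
  ext x
  have h : ‖(x : R4)‖ ^ 2 = 1 := by simp
  rw [EuclideanSpace.real_norm_sq_eq, Fin.sum_univ_four] at h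
  change (x : R4) 0 * (x : R4) 0 + (x : R4) 1 * (x : R4) 1 + (x : R4) 2 * (x : R4) 2 +
    (x : R4) 3 * (x : R4) 3 = 1
  linarith

/-- Tangency to the sphere, from differentiating `|x|² = 1`. -/
lemma sum_coord_mul_derivation (D : VF CS3) : coord 0 * D (coord 0) + coord 1 * D (coord 1) +
    coord 2 * D (coord 2) + coord 3 * D (coord 3) = 0 := by
  have h := congrArg D sum_coord_sq
  simp only [map_add, Derivation.leibniz, Derivation.map_one_eq_zero, smul_eq_mul] at h
  apply eq_of_two_mul_eq
  linear_combination h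

lemma coordFun_field1 : coordFun field1.toLin 0 = coord 1 ∧ coordFun field1.toLin 1 = -coord 0 ∧
    coordFun field1.toLin 2 = coord 3 ∧ coordFun field1.toLin 3 = -coord 2 :=
  ⟨rfl, rfl, rfl, rfl⟩

lemma coordFun_field2 : coordFun field2.toLin 0 = coord 2 ∧ coordFun field2.toLin 1 = -coord 3 ∧
    coordFun field2.toLin 2 = -coord 0 ∧ coordFun field2.toLin 3 = coord 1 :=
  ⟨rfl, rfl, rfl, rfl⟩

lemma coordFun_field3 : coordFun field3.toLin 0 = coord 3 ∧ coordFun field3.toLin 1 = coord 2 ∧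
    coordFun field3.toLin 2 = -coord 1 ∧ coordFun field3.toLin 3 = -coord 0 :=
  ⟨rfl, rfl, rfl, rfl⟩

lemma V1_coord : V1 (coord 0) = coord 1 ∧ V1 (coord 1) = -coord 0 ∧
    V1 (coord 2) = coord 3 ∧ V1 (coord 3) = -coord 2 := by
  simpa only [V1, sphereVF_coord] using coordFun_field1

lemma V2_coord : V2 (coord 0) = coord 2 ∧ V2 (coord 1) = -coord 3 ∧
    V2 (coord 2) = -coord 0 ∧ V2 (coord 3) = coord 1 := by
  simpa only [V2, sphereVF_coord] using coordFun_field2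

lemma V3_coord : V3 (coord 0) = coord 3 ∧ V3 (coord 1) = coord 2 ∧
    V3 (coord 2) = -coord 1 ∧ V3 (coord 3) = -coord 0 := by
  simpa only [V3, sphereVF_coord] using coordFun_field3

lemma ν1_apply (X : VF CS3) : ν1 X = coord 1 * X (coord 0) - coord 0 * X (coord 1) +
    coord 3 * X (coord 2) - coord 2 * X (coord 3) := by
  change ∑ k, coordFun field1.toLin k * X (coord k) = _
  rw [Fin.sum_univ_four, coordFun_field1.1, coordFun_field1.2.1, coordFun_field1.2.2.1,
    coordFun_field1.2.2.2]
  ring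

lemma ν2_apply (X : VF CS3) : ν2 X = coord 2 * X (coord 0) - coord 3 * X (coord 1) -
    coord 0 * X (coord 2) + coord 1 * X (coord 3) := by
  change ∑ k, coordFun field2.toLin k * X (coord k) = _
  rw [Fin.sum_univ_four, coordFun_field2.1, coordFun_field2.2.1, coordFun_field2.2.2.1,
    coordFun_field2.2.2.2]
  ring

lemma ν3_apply (X : VF CS3) : ν3 X = coord 3 * X (coord 0) + coord 2 * X (coord 1) -
    coord 1 * X (coord 2) - coord 0 * X (coord 3) := by
  change ∑ k, coordFun field3.toLin k * X (coord k) = _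
  rw [Fin.sum_univ_four, coordFun_field3.1, coordFun_field3.2.1, coordFun_field3.2.2.1,
    coordFun_field3.2.2.2]
  ring

/-- The left-invariant frame of `S³`. -/
def sphereFrame : SU2Frame CS3 where
  v1 := V1
  v2 := V2
  v3 := V3
  n1 := ν1
  n2 := ν2
  n3 := ν3
  n1_v1 := by simp only [ν1_apply, V1_coord]; linear_combination sum_coord_sq
  n1_v2 := by simp only [ν1_apply, V2_coord]; ring
  n1_v3 := by simp only [ν1_apply, V3_coord]; ring
  n2_v1 := by simp only [ν2_apply, V1_coord]; ring
  n2_v2 := by simp only [ν2_apply, V2_coord]; linear_combination sum_coord_sq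
  n2_v3 := by simp only [ν2_apply, V3_coord]; ring
  n3_v1 := by simp only [ν3_apply, V1_coord]; ring
  n3_v2 := by simp only [ν3_apply, V2_coord]; ring
  n3_v3 := by simp only [ν3_apply, V3_coord]; linear_combination sum_coord_sq
  -- The position vector and the three linear fields are orthonormal in `ℝ⁴`, and `X` has no
  -- component along the position vector.
  expand X := by
    have h := sum_coord_mul_derivation X
    apply derivation_ext_coord
    intro k
    simp only [Derivation.add_apply, Derivation.smul_apply, smul_eq_mul, ν1_apply, ν2_apply,
      ν3_apply]
    fin_cases k
    · simp only [Fin.zero_eta, V1_coord, V2_coord, V3_coord]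
      linear_combination -X (coord 0) * sum_coord_sq + coord 0 * h
    · simp only [Fin.mk_one, V1_coord, V2_coord, V3_coord]
      linear_combination -X (coord 1) * sum_coord_sq + coord 1 * h
    · simp only [Fin.reduceFinMk, V1_coord, V2_coord, V3_coord]
      linear_combination -X (coord 2) * sum_coord_sq + coord 2 * h
    · simp only [Fin.reduceFinMk, V1_coord, V2_coord, V3_coord]
      linear_combination -X (coord 3) * sum_coord_sq + coord 3 * h
  lie12 := by
    apply derivation_ext_coord
    intro k
    fin_cases k <;>
      simp [Derivation.commutator_apply, V1_coord, V2_coord, V3_coord] <;> ring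
  lie23 := by
    apply derivation_ext_coord
    intro k
    fin_cases k <;>
      simp [Derivation.commutator_apply, V1_coord, V2_coord, V3_coord] <;> ring
  lie31 := by
    apply derivation_ext_coord
    intro k
    fin_cases k <;>
      simp [Derivation.commutator_apply, V1_coord, V2_coord, V3_coord] <;> ring

/-- An idempotent function takes only the values 0 and 1, so its zero set is clopen in the connected
space `S³`. -/
lemma eq_zero_or_one_of_mul_self (a : CS3) (h : a * a = a) : a = 0 ∨ a = 1 := by
  have hx : ∀ x, a x = 0 ∨ a x = 1 := fun x => by
    have h1 : a x * a x = a x := congrArg (fun b : CS3 => b x) h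
    rcases mul_eq_zero.1 (show a x * (a x - 1) = 0 by linear_combination h1) with h2 | h2
    · exact Or.inl h2
    · exact Or.inr (sub_eq_zero.1 h2)
  have hconn : IsPreconnected (Metric.sphere (0 : R4) 1) :=
    isPreconnected_sphere (by simp [← Module.finrank_eq_rank]) 0 1
  have : PreconnectedSpace S3 := isPreconnected_iff_preconnectedSpace.1 hconn
  have hclopen : IsClopen {x | a x = 0} := by
    have hcont : Continuous a := a.contMDiff.continuous
    refine ⟨isClosed_eq hcont continuous_const, ?_⟩
    have h2 : {x | a x = 0} = {x | a x < 1} := by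
      ext x
      rcases hx x with h3 | h3 <;> simp [h3]
    rw [h2]
    exact isOpen_lt hcont continuous_const
  rcases isClopen_iff.1 hclopen with h3 | h3
  · right
    ext x
    exact (hx x).resolve_left fun h4 => by simpa [h3] using (show x ∈ {x | a x = 0} from h4)
  · left
    ext x
    exact (show x ∈ {x | a x = 0} from h3 ▸ Set.mem_univ x)

lemma sphereJ_isBlock (f g : CS3) : sphereFrame.IsBlock f g (sphereJ f g) := by
  intro a1 a2 a3 b1 b2 b3 p q
  have h11 : ν1 V1 = 1 := sphereFrame.n1_v1
  have h12 : ν1 V2 = 0 := sphereFrame.n1_v2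
  have h13 : ν1 V3 = 0 := sphereFrame.n1_v3
  have h21 : ν2 V1 = 0 := sphereFrame.n2_v1
  have h22 : ν2 V2 = 1 := sphereFrame.n2_v2
  have h23 : ν2 V3 = 0 := sphereFrame.n2_v3
  have h31 : ν3 V1 = 0 := sphereFrame.n3_v1
  have h32 : ν3 V2 = 0 := sphereFrame.n3_v2
  have h33 : ν3 V3 = 1 := sphereFrame.n3_v3
  change (((sphereSmallJ (a1 • V1 + a2 • V2 + a3 • V3, p) +
      sphereΛ f g (b1 • ν1 + b2 • ν2 + b3 • ν3, q)).1,
      (-coneDual sphereSmallJ (b1 • ν1 + b2 • ν2 + b3 • ν3, q)).1),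
    ((sphereSmallJ (a1 • V1 + a2 • V2 + a3 • V3, p) +
      sphereΛ f g (b1 • ν1 + b2 • ν2 + b3 • ν3, q)).2,
      (-coneDual sphereSmallJ (b1 • ν1 + b2 • ν2 + b3 • ν3, q)).2)) = _
  simp only [SU2Frame.csec, SU2Frame.sec, Prod.mk.injEq]
  change (_ = _ • V1 + _ • V2 + _ • V3 ∧ _ = _ • ν1 + _ • ν2 + _ • ν3) ∧ _ = _ ∧ _ = _
  refine ⟨⟨?_, ?_⟩, ?_, ?_⟩
  · simp [sphereSmallJ, sphereΛ, wedge, coneEval, h11, h12, h13, h21, h22, h23, h31, h32, h33]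
    module
  · apply sphereFrame.form_ext
    · change _ = (_ • ν1 + _ • ν2 + _ • ν3) V1
      change -(coneEval _ (sphereSmallJ (V1, 0))) = _
      simp [sphereSmallJ, coneEval, h11, h21, h31]
    · change _ = (_ • ν1 + _ • ν2 + _ • ν3) V2
      change -(coneEval _ (sphereSmallJ (V2, 0))) = _
      simp [sphereSmallJ, coneEval, h12, h13, h22, h23, h32, h33]
    · change _ = (_ • ν1 + _ • ν2 + _ • ν3) V3
      change -(coneEval _ (sphereSmallJ (V3, 0))) = _
      simp [sphereSmallJ, coneEval, h12, h13, h22, h23, h32, h33]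
  · simp [sphereSmallJ, sphereΛ, wedge, coneEval, h11, h12, h13, h21, h22, h23, h31, h32, h33]
    ring
  · change -(coneEval _ (sphereSmallJ (0, 1))) = _
    simp [sphereSmallJ, coneEval, h11, h21, h31]

end SphereFrame

end GenContact

end

theorem mainTheorem11 (f g : GenContact.CS3) :
    GenContact.IsSek0 (GenContact.sphereJ f g) ∧
    GenContact.IsIntegrable (GenContact.sphereE f g) (GenContact.sphereL f g) ∧
    (GenContact.IsStronglyIntegrable (GenContact.sphereE f g) (GenContact.sphereL f g) ↔
      GenContact.IsInvolutive (GenContact.sphereL f g)) ∧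
    (GenContact.IsStronglyIntegrable (GenContact.sphereE f g) (GenContact.sphereL f g) ↔
      GenContact.V2 g + GenContact.V3 f = 0 ∧ GenContact.V2 f - GenContact.V3 g = 0) ∧
    (GenContact.IsNormal (GenContact.sphereE f g) (GenContact.sphereL f g) ↔
      (GenContact.V2 g + GenContact.V3 f = 0 ∧ GenContact.V2 f - GenContact.V3 g = 0) ∧
        (GenContact.V1 g + 2 * f = 0 ∧ GenContact.V1 f - 2 * g = 0)) ∧
    (GenContact.IsNormalTriple (GenContact.tripleΦ (GenContact.sphereJ f g))
        (GenContact.tripleE1 (GenContact.sphereJ f g))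
        (GenContact.tripleE2 (GenContact.sphereJ f g)) ↔
      (GenContact.V2 g + GenContact.V3 f = 0 ∧ GenContact.V2 f - GenContact.V3 g = 0) ∧
        (GenContact.V1 g + 2 * f = 0 ∧ GenContact.V1 f - 2 * g = 0)) := by
  have hJ := GenContact.sphereJ_isBlock f g
  have hA := GenContact.eq_zero_or_one_of_mul_self
  exact ⟨hJ.isSek0, hJ.isIntegrable, hJ.isStronglyIntegrable_iff hA,
    (hJ.isStronglyIntegrable_iff hA).trans hJ.isInvolutive_bundleL_iff, hJ.isNormal_iff,
    hJ.isNormalTriple_iff⟩
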